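/- Let $\Delta\subset\mathbb R^2$ be a Delzant polygon, that is, a convex polygon with nonempty interior whose sides have rational slopes, such that for any two adjacent sides the primitive integer vectors in their directions form a basis of $\mathbb Z^2$. (The vertices need not be lattice points.) *The particle process.* At time $0$ put at every vertex of $\Delta$ a particle of mass $1$, whose velocity is the sum of the two primitive integer vectors pointing from this vertex along the two sides adjacent to it. Particles move rectilinearly at constant velocity until they collide. Whenever a group of two or more particles meets at one point, they are replaced by a single particle starting at this point with the same total momentum (momentum is mass times velocity), its mass being a positive integer and its velocity a primitive integer vector; if the total momentum is $0$, the particles annihilate and no new particle is emitted. Let $C_\Delta$ be the set of all points traced by the particles, each edge of $C_\Delta$ being weighted by the mass of the particles that trace it. *The function.* For a side $s$ of $\Delta$ let $\lambda_s$ be the lattice distance to the line through $s$, i.e. the affine function with primitive integer gradient which vanishes on $s$ and is nonnegative on $\Delta$. Put $F_\Delta(p)=\min_s\lambda_s(p)$ for $p\in\Delta$, the minimum being over all sides of $\Delta$. Then $C_\Delta$ is the corner locus of $F_\Delta$: $$C_\Delta=\{p\in\Delta : F_\Delta \text{ is not smooth (as a function on } \Delta\text{) at } p\}.$$ Moreover,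 the weights agree: if a particle of mass $m$ passes through a point $x$ at a time strictly between two consecutive collision times (the start counting as the first of these times), then near $x$ the function $F_\Delta$ is the minimum of two distinct affine functions, equal at $x$, with integer gradients $v$ and $w$, and the lattice length of $v-w$ (the greatest common divisor of its coordinates) is $m$. -/

import Mathlib

open scoped Topology ContDiff

noncomputable section

namespace Caustic

/-- The determinant of a lattice vector and a vector of the plane. -/
def det (u : ℤ × ℤ) (w : ℝ × ℝ) : ℝ := (u.1 : ℝ) * w.2 - (u.2 : ℝ) * w.1

/-- The lattice vector `u`, viewed in the plane. -/
def toPlane (u : ℤ × ℤ) : ℝ × ℝ := ((u.1 : ℝ), (u.2 : ℝ))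

/-- The lattice length of an integer vector. -/
def latticeLength (u : ℤ × ℤ) : ℕ := Int.gcd u.1 u.2

/-- A convex polygon in the plane, with nonempty interior and sides of rational slope, given by
its `n` vertices in counterclockwise order. The `i`-th side joins `vertex i` to `vertex (i + 1)`,
has primitive direction vector `dir i` and lattice length `len i`; every vertex that is not an end
of this side lies strictly to the left of it. -/
structure RationalPolygon (n : ℕ) where
  three_le : 3 ≤ n
  vertex : ZMod n → ℝ × ℝ
  dir : ZMod n → ℤ × ℤ
  len : ZMod n → ℝ
  len_pos : ∀ i, 0 < len i
  primitive : ∀ i, latticeLength (dir i) = 1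
  vertex_succ : ∀ i, vertex (i + 1) = vertex i + len i • toPlane (dir i)
  convex : ∀ i j, j ≠ i → j ≠ i + 1 → 0 < det (dir i) (vertex j - vertex i)

/-- A point particle with a positive integer mass and an integer velocity. -/
structure Particle where
  pos : ℝ × ℝ
  mass : ℕ
  vel : ℤ × ℤ

namespace Particle

/-- The position after time `t` of uniform rectilinear motion. -/
def posAfter (q : Particle) (t : ℝ) : ℝ × ℝ := q.pos + t • toPlane q.vel

/-- Mass times velocity. -/
def momentum (q : Particle) : ℤ × ℤ := (q.mass : ℤ) • q.vel

/-- The particle at `x` with momentum `m ≠ 0` and primitive velocity. -/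
def ofMomentum (x : ℝ × ℝ) (m : ℤ × ℤ) : Particle where
  pos := x
  mass := latticeLength m
  vel := (m.1 / (latticeLength m : ℤ), m.2 / (latticeLength m : ℤ))

end Particle

/-- The positive times at which some two particles of the system `S` would be at the same place if
all particles of `S` kept moving freely. -/
def collisionTimes (S : Finset Particle) : Set ℝ :=
  {t | 0 < t ∧ ∃ p ∈ S, ∃ q ∈ S, p ≠ q ∧ p.posAfter t = q.posAfter t}

/-- The times up to and including the first collision: `[0, τ]` if the first collision happens at
time `τ`, and `[0, ∞)` if there is no collision. -/
def freePhase (S : Finset Particle) : Set ℝ :=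
  {t | 0 ≤ t ∧ ∀ s ∈ collisionTimes S, t ≤ s}

open Classical in
/-- Total momentum of the particles of `S` that are at `x` after time `t`. -/
def momentumAt (S : Finset Particle) (t : ℝ) (x : ℝ × ℝ) : ℤ × ℤ :=
  ∑ q ∈ S.filter (fun q => q.posAfter t = x), q.momentum

open Classical in
/-- The system immediately after the collisions at time `t`. All particles at one place are
replaced by a single particle with the same total momentum, or by nothing if this momentum is zero.
A particle that is alone at its place is kept: it has primitive velocity, so it is the particle
determined by its place and its momentum. -/
def merge (S : Finset Particle) (t : ℝ) : Finset Particle :=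
  ((S.image fun q => q.posAfter t).filter fun x => momentumAt S t x ≠ 0).image
    fun x => Particle.ofMomentum x (momentumAt S t x)

open Classical in
/-- The system immediately after its first collision time; if nothing ever collides, the process is
over after the present (infinite) phase. -/
def next (S : Finset Particle) : Finset Particle :=
  if (collisionTimes S).Nonempty then merge S (sInf (collisionTimes S)) else ∅

/-- The corner locus in `D` of a function: the points of `D` where it is not smooth on `D`. -/
def cornerLocus (D : Set (ℝ × ℝ)) (F : ℝ × ℝ → ℝ) : Set (ℝ × ℝ) :=
  {x ∈ D | ¬ ContDiffWithinAt ℝ ∞ F D x}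

/-- The point `x` of `D` lies inside an edge of multiplicity `m` of the corner locus of `F`: near
`x` the function `F` is the minimum of two distinct affine functions, both attaining this minimum
at `x`, with integral gradients `v` and `w` such that `v - w` has lattice length `m`. -/
def HasEdgeMultiplicity (D : Set (ℝ × ℝ)) (F : ℝ × ℝ → ℝ) (x : ℝ × ℝ) (m : ℕ) : Prop :=
  ∃ (v w : ℤ × ℤ) (a b : ℝ), v ≠ w ∧
    a + (v.1 * x.1 + v.2 * x.2) = b + (w.1 * x.1 + w.2 * x.2) ∧
    (∀ᶠ y in 𝓝[D] x,
      F y = min (a + (v.1 * y.1 + v.2 * y.2)) (b + (w.1 * y.1 + w.2 * y.2))) ∧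
    latticeLength (v - w) = m

namespace RationalPolygon

variable {n : ℕ} (P : RationalPolygon n)

/-- The polygon as a set. -/
def carrier : Set (ℝ × ℝ) := convexHull ℝ (Set.range P.vertex)

/-- The primitive vectors in the directions of any two adjacent sides form a basis of `ℤ²`. -/
def IsDelzant : Prop :=
  ∀ i, ∃ b : Module.Basis (Fin 2) ℤ (ℤ × ℤ), b 0 = P.dir i ∧ b 1 = P.dir (i + 1)

/-- The lattice distance to the line through the `i`-th side, that is, the Euclidean distance times
the Euclidean length of the primitive vector `dir i`. It is written as an affine function with
integral gradient, nonnegative on the polygon. -/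
def sideDist (i : ZMod n) (p : ℝ × ℝ) : ℝ := det (P.dir i) (p - P.vertex i)

/-- The minimum over all sides of the lattice distance to the side. -/
def distFun [NeZero n] (p : ℝ × ℝ) : ℝ :=
  Finset.univ.inf' Finset.univ_nonempty fun i => P.sideDist i p

open Classical in
/-- The initial system: at every vertex one particle of mass one, its velocity being the sum of the
primitive vectors which point from this vertex along the two sides adjacent to it. -/
def initial [NeZero n] : Finset Particle :=
  Finset.univ.image fun i => ⟨P.vertex i, 1, P.dir i - P.dir (i - 1)⟩

/-- The system after `k` collision times. -/
def system [NeZero n] (k : ℕ) : Finset Particle := next^[k] P.initial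

/-- The set traced by all particles. -/
def trace [NeZero n] : Set (ℝ × ℝ) :=
  {x | ∃ k, ∃ q ∈ P.system k, ∃ t ∈ freePhase (P.system k), x = q.posAfter t}

end RationalPolygon

end Caustic

end

/-! Push every side inwards at unit lattice speed. At time `t` the moving front bounds the set where
the minimum of the distances is at least `t`. A vertex between sides of directions `u`, `w` with
`cross u w = 1` stays at level `t` of both when its velocity is `w - u`, so the vertices move
exactly as the particles of mass one. Until a side shrinks to a point, the points where two sides
realise the minimum are therefore the points traced by the vertices (`lt_dist_point`,
`exists_eq_point`).

The directions of the neighbours of side `i` add up to `turn i • dir i`, so this side shrinks at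
rate `2 - turn i`, and since the polygon closes up, some side does collapse (`exists_collapse`). If
all collapsing sides have turn one and no two are adjacent, removing them leaves consecutive
directions of determinant one, hence a front with fewer sides. Momentum at each point is unchanged
(`momentumAt_front`), and a removed distance, being the sum of its neighbours' up to a constant,
exceeds the minimum at all higher levels (`dist_of_lenAt_eq_zero`). Induction on the number of sides
applies.

In every other case the front is finished: it shrinks to a point, or two opposite sides merge into
one segment, whose ends emit particles of mass two that meet in the middle and annihilate.

It remains to see that the minimum is not smooth exactly where two sides realise it. In the interior
a derivative would have to equal the gradients of both sides; on the boundary only vertices occur,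
and there the derivative would vanish along both sides but be one along the velocity. -/

noncomputable section

namespace Caustic

/-! ### Determinants of lattice vectors -/

/-- The determinant of two lattice vectors. -/
def cross (u w : ℤ × ℤ) : ℤ := u.1 * w.2 - u.2 * w.1

theorem det_toPlane (u w : ℤ × ℤ) : det u (toPlane w) = (cross u w : ℝ) := by
  simp [det, toPlane, cross]

theorem det_add (u : ℤ × ℤ) (x y : ℝ × ℝ) : det u (x + y) = det u x + det u y := by
  simp only [det, Prod.fst_add, Prod.snd_add]; ring

theorem det_sub (u : ℤ × ℤ) (x y : ℝ × ℝ) : det u (x - y) = det u x - det u y := by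
  simp only [det, Prod.fst_sub, Prod.snd_sub]; ring

theorem det_smul (u : ℤ × ℤ) (t : ℝ) (x : ℝ × ℝ) : det u (t • x) = t * det u x := by
  simp only [det, Prod.smul_fst, Prod.smul_snd, smul_eq_mul]; ring

theorem toPlane_sub (u w : ℤ × ℤ) : toPlane (u - w) = toPlane u - toPlane w := by
  simp [toPlane]

theorem cross_self (u : ℤ × ℤ) : cross u u = 0 := by
  simp only [cross]; ring

theorem cross_anticomm (u w : ℤ × ℤ) : cross u w = -cross w u := by
  simp only [cross]; ring

/-- Expansion of a lattice vector in a basis of determinant one. -/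
theorem det_eq_of_cross_eq_one {u w : ℤ × ℤ} (h : cross u w = 1) (z : ℤ × ℤ) (x : ℝ × ℝ) :
    det z x = cross z w * det u x + cross u z * det w x := by
  have h' : (u.1 * w.2 - u.2 * w.1 : ℝ) = 1 := by exact_mod_cast h
  simp only [det, cross]
  push_cast
  linear_combination (-(z.1 * x.2 - z.2 * x.1 : ℝ)) * h'

theorem eq_of_cross_eq_one {u w : ℤ × ℤ} (h : cross u w = 1) (z : ℤ × ℤ) :
    z = cross z w • u + cross u z • w := by
  simp only [cross] at *
  ext
  · simp only [Prod.fst_add, Prod.smul_fst, smul_eq_mul]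
    linear_combination (-z.1) * h
  · simp only [Prod.snd_add, Prod.smul_snd, smul_eq_mul]
    linear_combination (-z.2) * h

/-- A vector whose determinants with a basis vanish is zero. -/
theorem eq_zero_of_det_eq_zero {u w : ℤ × ℤ} (h : cross u w ≠ 0) {x : ℝ × ℝ}
    (hu : det u x = 0) (hw : det w x = 0) : x = 0 := by
  have h' : (u.1 * w.2 - u.2 * w.1 : ℝ) ≠ 0 := by exact_mod_cast h
  simp only [det] at hu hw
  ext
  · apply mul_left_cancel₀ h'
    simp only [Prod.fst_zero, mul_zero]
    linear_combination w.1 * hu - u.1 * hw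
  · apply mul_left_cancel₀ h'
    simp only [Prod.snd_zero, mul_zero]
    linear_combination w.2 * hu - u.2 * hw

theorem latticeLength_sub_of_cross_eq_one {u w : ℤ × ℤ} (h : cross u w = 1) :
    latticeLength (w - u) = 1 := by
  apply Int.isCoprime_iff_gcd_eq_one.mp
  refine ⟨-u.2, u.1, ?_⟩
  simp only [cross, Prod.fst_sub, Prod.snd_sub] at *
  linear_combination h

theorem latticeLength_of_cross_eq_one {u w : ℤ × ℤ} (h : cross u w = 1) :
    latticeLength u = 1 := by
  apply Int.isCoprime_iff_gcd_eq_one.mp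
  refine ⟨w.2, -w.1, ?_⟩
  simp only [cross] at *
  linear_combination h

theorem latticeLength_neg (u : ℤ × ℤ) : latticeLength (-u) = latticeLength u := by
  simp [latticeLength]

theorem ofMomentum_of_latticeLength_eq_one (x : ℝ × ℝ) {m : ℤ × ℤ} (h : latticeLength m = 1) :
    Particle.ofMomentum x m = ⟨x, 1, m⟩ := by
  simp [Particle.ofMomentum, h]

/-! ### Fronts and the motion of their vertices -/

/-- A closed polygonal front: sides indexed by a finite type, in the cyclic order `succ`; side `i`
leads from `vertex i` to `vertex (succ i)`, consecutive directions have determinant one, and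
no direction lies in the cone of two consecutive other ones. -/
structure Front (ι : Type) where
  succ : Equiv.Perm ι
  vertex : ι → ℝ × ℝ
  dir : ι → ℤ × ℤ
  len : ι → ℝ
  len_pos : ∀ i, 0 < len i
  vertex_succ : ∀ i, vertex (succ i) = vertex i + len i • toPlane (dir i)
  cross_succ : ∀ i, cross (dir i) (dir (succ i)) = 1
  fan : ∀ i j, i ≠ j → i ≠ succ j →
    ¬(0 ≤ cross (dir j) (dir i) ∧ 0 ≤ cross (dir i) (dir (succ j)))

namespace Front

variable {ι : Type} (W : Front ι)

/-- The lattice distance to a side. -/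
def dist (i : ι) (x : ℝ × ℝ) : ℝ := det (W.dir i) (x - W.vertex i)

/-- The velocity of a vertex. -/
def vel (i : ι) : ℤ × ℤ := W.dir i - W.dir (W.succ.symm i)

/-- The position of a vertex after time `t`. -/
def point (i : ι) (t : ℝ) : ℝ × ℝ := W.vertex i + t • toPlane (W.vel i)

/-- The determinant of the two neighbours of a side. -/
def turn (i : ι) : ℤ := cross (W.dir (W.succ.symm i)) (W.dir (W.succ i))

/-- The lattice length of a side after time `t`. -/
def lenAt (i : ι) (t : ℝ) : ℝ := W.len i - (2 - W.turn i) * t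

theorem dist_add (i : ι) (x y : ℝ × ℝ) : W.dist i (x + y) = W.dist i x + det (W.dir i) y := by
  simp only [dist, det_sub, det_add]; ring

theorem dist_add_smul (i : ι) (x : ℝ × ℝ) (t : ℝ) (u : ℤ × ℤ) :
    W.dist i (x + t • toPlane u) = W.dist i x + t * cross (W.dir i) u := by
  rw [dist_add, det_smul, det_toPlane]

theorem dist_eq (i : ι) (x y : ℝ × ℝ) : W.dist i x = W.dist i y + det (W.dir i) (x - y) := by
  rw [← dist_add, add_sub_cancel]

theorem cross_pred (i : ι) : cross (W.dir (W.succ.symm i)) (W.dir i) = 1 := by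
  simpa using W.cross_succ (W.succ.symm i)

theorem dir_injective : Function.Injective W.dir := by
  intro i j h
  by_contra hij
  by_cases h' : i = W.succ j
  · have := W.cross_succ j
    rw [← h', h, cross_self] at this
    exact zero_ne_one this
  · refine W.fan i j hij h' ⟨?_, ?_⟩
    · rw [h, cross_self]
    · rw [h, W.cross_succ]; exact zero_le_one

theorem succ_ne (i : ι) : W.succ i ≠ i := by
  intro h
  have := W.cross_succ i
  rw [h, cross_self] at this
  exact zero_ne_one this

theorem pred_ne (i : ι) : W.succ.symm i ≠ i := by
  have := W.succ_ne (W.succ.symm i)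
  rw [Equiv.apply_symm_apply] at this
  exact this.symm

theorem succ_succ_ne (i : ι) : W.succ (W.succ i) ≠ i := by
  intro h
  have h1 := W.cross_succ i
  have h2 := W.cross_succ (W.succ i)
  rw [h, cross_anticomm] at h2
  omega

/-- In the basis formed by the directions of side `i` and its predecessor, the successor's direction
has coefficient `-1` at the predecessor. -/
theorem dir_pred_add_dir_succ (i : ι) :
    W.dir (W.succ.symm i) + W.dir (W.succ i) = W.turn i • W.dir i := by
  have h1 := W.cross_pred i
  have h2 := W.cross_succ i
  have h3 : cross (W.dir (W.succ i)) (W.dir i) = -1 := by rw [cross_anticomm, h2]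
  have h := eq_of_cross_eq_one h1 (W.dir (W.succ i))
  rw [h3] at h
  rw [turn]
  nth_rewrite 1 [h]
  simp

theorem det_pred_add_det_succ (i : ι) (x : ℝ × ℝ) :
    det (W.dir (W.succ.symm i)) x + det (W.dir (W.succ i)) x = W.turn i * det (W.dir i) x := by
  have h := W.dir_pred_add_dir_succ i
  have h1 : ((W.dir (W.succ.symm i)).1 + (W.dir (W.succ i)).1 : ℝ) = W.turn i * (W.dir i).1 := by
    exact_mod_cast congrArg Prod.fst h
  have h2 : ((W.dir (W.succ.symm i)).2 + (W.dir (W.succ i)).2 : ℝ) = W.turn i * (W.dir i).2 := by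
    exact_mod_cast congrArg Prod.snd h
  simp only [det]
  linear_combination x.2 * h1 - x.1 * h2

/-- This is why the vertices ride on the moving sides: along the velocity of vertex `i`, the
distance to side `i` grows at unit rate. -/
theorem cross_dir_vel (i : ι) : cross (W.dir i) (W.vel i) = 1 := by
  have := W.cross_pred i
  simp only [cross, vel, Prod.fst_sub, Prod.snd_sub] at *
  linear_combination this

theorem latticeLength_vel (i : ι) : latticeLength (W.vel i) = 1 :=
  latticeLength_sub_of_cross_eq_one (W.cross_pred i)

theorem point_zero (i : ι) : W.point i 0 = W.vertex i := by simp [point]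

theorem lenAt_zero (i : ι) : W.lenAt i 0 = W.len i := by simp [lenAt]

/-- The two ends of side `i` have velocities differing by `(turn i - 2) • dir i`, so the side keeps
its direction and changes length linearly. -/
theorem point_succ (i : ι) (t : ℝ) :
    W.point (W.succ i) t = W.point i t + W.lenAt i t • toPlane (W.dir i) := by
  have h := W.dir_pred_add_dir_succ i
  have h1 : ((W.dir (W.succ.symm i)).1 + (W.dir (W.succ i)).1 : ℝ) = W.turn i * (W.dir i).1 := by
    exact_mod_cast congrArg Prod.fst h
  have h2 : ((W.dir (W.succ.symm i)).2 + (W.dir (W.succ i)).2 : ℝ) = W.turn i * (W.dir i).2 := by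
    exact_mod_cast congrArg Prod.snd h
  simp only [point, vel, lenAt, W.vertex_succ, Equiv.symm_apply_apply]
  ext
  · simp [toPlane]
    linear_combination t * h1
  · simp [toPlane]
    linear_combination t * h2

theorem dist_point_self (i : ι) (t : ℝ) : W.dist i (W.point i t) = t := by
  rw [point, dist_add_smul, cross_dir_vel]
  simp [dist, det]

theorem dist_point_succ (i : ι) (t : ℝ) : W.dist i (W.point (W.succ i) t) = t := by
  rw [point_succ, dist_add_smul, dist_point_self, cross_self]
  simp

theorem dist_pred_point (i : ι) (t : ℝ) : W.dist (W.succ.symm i) (W.point i t) = t := by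
  simpa using W.dist_point_succ (W.succ.symm i) t

/-! ### Convexity of the moving front and the first collapse -/

section Finite

variable [Finite ι]

/-- While all sides have positive length, the front stays strictly convex. -/
theorem lt_dist_point {t : ℝ} (ht : ∀ i, 0 < W.lenAt i t) {i j : ι} (h1 : j ≠ i)
    (h2 : j ≠ W.succ i) : t < W.dist i (W.point j t) := by
  -- At a vertex closest to the line of side `i`, the incoming side does not ascend and the outgoing
  -- one does not descend. Then `dir i` lies in the cone of these two directions, which `fan` allows
  -- only if `i` is one of the two sides.
  have key : ∀ j, (∀ l, W.dist i (W.point j t) ≤ W.dist i (W.point l t)) →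
      j = i ∨ j = W.succ i := by
    intro j hj
    by_contra! hne
    have hs := hj (W.succ j)
    have hp := hj (W.succ.symm j)
    have e : W.point j t = W.point (W.succ.symm j) t +
        W.lenAt (W.succ.symm j) t • toPlane (W.dir (W.succ.symm j)) := by
      simpa using W.point_succ (W.succ.symm j) t
    rw [point_succ, dist_add_smul] at hs
    rw [e, dist_add_smul] at hp
    have hs' : (0 : ℝ) ≤ cross (W.dir i) (W.dir j) := by
      have := ht j
      by_contra! h
      nlinarith
    have hp' : (cross (W.dir i) (W.dir (W.succ.symm j)) : ℝ) ≤ 0 := by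
      have := ht (W.succ.symm j)
      by_contra! h
      nlinarith
    refine W.fan i (W.succ.symm j) ?_ ?_ ⟨?_, ?_⟩
    · intro h; apply hne.2; rw [h]; simp
    · intro h; apply hne.1; rw [h]; simp
    · rw [cross_anticomm]
      have : cross (W.dir i) (W.dir (W.succ.symm j)) ≤ 0 := by exact_mod_cast hp'
      omega
    · simpa using (by exact_mod_cast hs' : 0 ≤ cross (W.dir i) (W.dir j))
  have : Nonempty ι := ⟨i⟩
  obtain ⟨m, hm⟩ := Finite.exists_min fun l => W.dist i (W.point l t)
  have hmt : W.dist i (W.point m t) = t := by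
    rcases key m hm with rfl | rfl
    · exact W.dist_point_self _ t
    · exact W.dist_point_succ _ t
  have hle : ∀ l, t ≤ W.dist i (W.point l t) := fun l => hmt.symm.le.trans (hm l)
  refine lt_of_le_of_ne (hle j) fun h => ?_
  rcases key j (fun l => by rw [← h]; exact hle l) with h | h
  · exact h1 h
  · exact h2 h

theorem le_dist_point_of_pos {t : ℝ} (ht : ∀ i, 0 < W.lenAt i t) (i j : ι) :
    t ≤ W.dist i (W.point j t) := by
  by_cases h1 : j = i
  · rw [h1, dist_point_self]
  by_cases h2 : j = W.succ i
  · rw [h2, dist_point_succ]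
  exact (W.lt_dist_point ht h1 h2).le

omit [Finite ι] in
theorem lenAt_pos_of_lt {t τ : ℝ} (hτ : ∀ i, 0 ≤ W.lenAt i τ) (h0 : 0 ≤ t) (h : t < τ) (i : ι) :
    0 < W.lenAt i t := by
  have h1 := hτ i
  have h2 := W.len_pos i
  simp only [lenAt] at *
  by_cases hc : (2 - W.turn i : ℝ) ≤ 0
  · nlinarith
  · push Not at hc
    nlinarith

theorem le_dist_point {τ : ℝ} (hτ : ∀ i, 0 ≤ W.lenAt i τ) {t : ℝ} (h0 : 0 ≤ t) (ht : t ≤ τ)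
    (i j : ι) : t ≤ W.dist i (W.point j t) := by
  rcases ht.lt_or_eq with ht | rfl
  · exact W.le_dist_point_of_pos (W.lenAt_pos_of_lt hτ h0 ht) i j
  rcases h0.eq_or_lt with rfl | h0
  · apply W.le_dist_point_of_pos
    intro i
    rw [lenAt_zero]
    exact W.len_pos i
  -- At the collapse time itself the inequality survives as a limit from the left.
  have hc : Continuous fun r => W.dist i (W.point j r) := by
    have : (fun r => W.dist i (W.point j r)) =
        fun r => W.dist i (W.vertex j) + r * cross (W.dir i) (W.vel j) := by
      funext r
      rw [point, dist_add_smul]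
    rw [this]
    fun_prop
  refine le_of_tendsto_of_tendsto (b := 𝓝[<] t) (f := fun r => r)
    (continuous_id.continuousAt.mono_left nhdsWithin_le_nhds)
    (hc.continuousAt.mono_left nhdsWithin_le_nhds) ?_
  filter_upwards [Ioo_mem_nhdsLT h0] with r hr
  exact W.le_dist_point_of_pos (W.lenAt_pos_of_lt hτ hr.1.le hr.2) i j

end Finite

/-- A point at the level `t` of the side `i` which is not below this level for any
side lies on the side at time `t`. -/
theorem exists_eq_point_add {t : ℝ} {i : ι} {x : ℝ × ℝ} (hi : W.dist i x = t)
    (hx : ∀ l, t ≤ W.dist l x) :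
    ∃ a, 0 ≤ a ∧ a ≤ W.lenAt i t ∧ x = W.point i t + a • toPlane (W.dir i) := by
  -- Since the predecessor and side `i` have determinant one, this is the lattice coordinate along
  -- the side. The predecessor bounds it below, the successor above.
  set a := det (W.dir (W.succ.symm i)) (x - W.point i t) with ha
  have e : x = W.point i t + a • toPlane (W.dir i) := by
    rw [← sub_eq_zero]
    refine eq_zero_of_det_eq_zero (u := W.dir (W.succ.symm i)) (w := W.dir i)
      (by rw [W.cross_pred]; exact one_ne_zero) ?_ ?_
    · rw [← sub_sub, det_sub, ← ha, det_smul, det_toPlane, W.cross_pred]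
      simp
    · rw [← sub_sub, det_sub, det_smul, det_toPlane, cross_self]
      have := W.dist_eq i x (W.point i t)
      rw [hi, dist_point_self] at this
      simp only [Int.cast_zero, mul_zero, sub_zero]
      linarith
  refine ⟨a, ?_, ?_, e⟩
  · have := W.dist_eq (W.succ.symm i) x (W.point i t)
    rw [dist_pred_point] at this
    linarith [hx (W.succ.symm i)]
  · have h1 := hx (W.succ i)
    have h2 : x = W.point (W.succ i) t + (a - W.lenAt i t) • toPlane (W.dir i) := by
      rw [point_succ, sub_smul, e]; abel
    have h3 := W.cross_succ i
    rw [cross_anticomm] at h3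
    have h4 : cross (W.dir (W.succ i)) (W.dir i) = -1 := by omega
    rw [h2, dist_add_smul, dist_point_self, h4] at h1
    push_cast at h1
    linarith

/-- While all sides have positive length, only vertices are on two sides. -/
theorem exists_eq_point [Finite ι] {t : ℝ} (ht : ∀ i, 0 < W.lenAt i t) {i j : ι} (hij : i ≠ j)
    {x : ℝ × ℝ} (hi : W.dist i x = t) (hj : W.dist j x = t) (hx : ∀ l, t ≤ W.dist l x) :
    ∃ k, x = W.point k t := by
  obtain ⟨a, h0, h1, rfl⟩ := W.exists_eq_point_add hi hx
  rcases h0.eq_or_lt with rfl | h0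
  · exact ⟨i, by simp⟩
  rcases h1.eq_or_lt with rfl | h1
  · exact ⟨W.succ i, (W.point_succ i t).symm⟩
  exfalso
  -- The distance to `j` is affine on side `i`, at least `t` at both ends and equal to `t` inside,
  -- hence constant. Both ends then lie on side `j`, so by strict convexity `i` and `j` would
  -- succeed each other both ways.
  have hA := W.le_dist_point_of_pos ht j i
  have hB := W.le_dist_point_of_pos ht j (W.succ i)
  rw [point_succ, dist_add_smul] at hB
  rw [dist_add_smul] at hj
  set z : ℝ := (cross (W.dir j) (W.dir i) : ℝ) with hz
  have hz0 : z = 0 := by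
    rcases lt_trichotomy z 0 with h | h | h
    · nlinarith
    · exact h
    · nlinarith
  have hAe : W.dist j (W.point i t) = t := by rw [hz0] at hj; linarith
  have hBe : W.dist j (W.point (W.succ i) t) = t := by
    rw [point_succ, dist_add_smul, ← hz, hz0, hAe]; simp
  have hiS : i = W.succ j := by
    by_contra h
    exact (W.lt_dist_point ht hij h).ne' hAe
  have hSi : W.succ i = j := by
    by_contra h
    refine (W.lt_dist_point ht h ?_).ne' hBe
    intro h'
    exact hij (W.succ.injective h')
  rw [← hSi] at hiS
  exact W.succ_succ_ne i hiS.symm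

theorem point_ne [Finite ι] {t : ℝ} (ht : ∀ i, 0 < W.lenAt i t) {i j : ι} (hij : i ≠ j) :
    W.point i t ≠ W.point j t := by
  intro h
  have hne : ∀ i, W.point (W.succ i) t ≠ W.point i t := by
    intro i h
    have h1 := W.point_succ i t
    have h2 := W.dist_pred_point i t
    have h3 : W.dist (W.succ.symm i) (W.point (W.succ i) t) = t + W.lenAt i t := by
      rw [h1, dist_add_smul, h2, W.cross_pred]; simp
    rw [h, h2] at h3
    linarith [ht i]
  have hj : j = W.succ i := by
    by_contra h'
    have := W.lt_dist_point ht hij.symm h'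
    rw [← h, dist_point_self] at this
    exact lt_irrefl _ this
  rw [hj] at h
  exact hne i h.symm

theorem sum_len_smul [Fintype ι] (u : ℤ × ℤ) : ∑ i, W.len i * det u (toPlane (W.dir i)) = 0 := by
  have h : ∀ i, W.len i * det u (toPlane (W.dir i)) =
      det u (W.vertex (W.succ i)) - det u (W.vertex i) := by
    intro i
    rw [W.vertex_succ, det_add, det_smul]; ring
  simp only [h, Finset.sum_sub_distrib]
  rw [Equiv.sum_comp W.succ fun i => det u (W.vertex i), sub_self]

/-- Some side collapses after a finite time. -/
theorem exists_collapse [Finite ι] [Nonempty ι] :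
    ∃ τ, 0 < τ ∧ (∀ i, 0 ≤ W.lenAt i τ) ∧ ∃ i, W.lenAt i τ = 0 := by
  classical
  have := Fintype.ofFinite ι
  -- Otherwise no side ever shrinks, and every distance must grow at rate at least one along every
  -- vertex trajectory. Pairing a vertex velocity with the closed chain of sides then gives a
  -- negative sum that has to vanish.
  have hex : ∃ i, W.turn i < 2 := by
    by_contra! h
    have hl : ∀ t, 0 ≤ t → ∀ i, 0 < W.lenAt i t := by
      intro t ht i
      have h1 : (2 : ℝ) ≤ W.turn i := by exact_mod_cast h i
      have := W.len_pos i
      simp only [lenAt]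
      nlinarith
    obtain ⟨j⟩ := ‹Nonempty ι›
    have hv : ∀ i, (1 : ℤ) ≤ cross (W.dir i) (W.vel j) := by
      intro i
      by_contra! hc
      have hc' : (cross (W.dir i) (W.vel j) : ℝ) ≤ 0 := by exact_mod_cast Int.lt_add_one_iff.mp hc
      have h1 : 0 ≤ W.dist i (W.vertex j) := by
        have := W.le_dist_point_of_pos (hl 0 le_rfl) i j
        rwa [point_zero] at this
      -- At this time the level exceeds the initial distance of the vertex, which has not grown.
      have h2 := W.le_dist_point_of_pos (hl (W.dist i (W.vertex j) + 1) (by linarith)) i j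
      rw [point, dist_add_smul] at h2
      nlinarith
    have hs := W.sum_len_smul (W.vel j)
    have : ∑ i, W.len i * det (W.vel j) (toPlane (W.dir i)) < 0 := by
      apply Finset.sum_neg _ ⟨j, Finset.mem_univ j⟩
      intro i _
      have h1 := W.len_pos i
      have h2 : (1 : ℝ) ≤ cross (W.dir i) (W.vel j) := by exact_mod_cast hv i
      rw [det_toPlane, cross_anticomm]
      push_cast
      nlinarith
    linarith
  set A := Finset.univ.filter fun i => W.turn i < 2 with hA
  have hAn : A.Nonempty := by
    obtain ⟨i, hi⟩ := hex
    exact ⟨i, Finset.mem_filter.mpr ⟨Finset.mem_univ i, hi⟩⟩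
  -- The quotient is the time at which a shrinking side reaches length zero.
  obtain ⟨m, hm, hmin⟩ := A.exists_min_image (fun i => W.len i / (2 - W.turn i)) hAn
  have hpos : ∀ i ∈ A, (0 : ℝ) < 2 - W.turn i := by
    intro i hi
    have : W.turn i < 2 := (Finset.mem_filter.mp hi).2
    have : (W.turn i : ℝ) < 2 := by exact_mod_cast this
    linarith
  have hτ : 0 < W.len m / (2 - W.turn m) := div_pos (W.len_pos m) (hpos m hm)
  refine ⟨W.len m / (2 - W.turn m), hτ, fun i => ?_, m, ?_⟩
  · by_cases hi : i ∈ A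
    · have h1 := hmin i hi
      rw [le_div_iff₀ (hpos i hi)] at h1
      simp only [lenAt]
      linarith
    · have : 2 ≤ W.turn i := by
        by_contra! h
        exact hi (Finset.mem_filter.mpr ⟨Finset.mem_univ i, h⟩)
      have : (2 : ℝ) ≤ W.turn i := by exact_mod_cast this
      have := W.len_pos i
      simp only [lenAt]
      nlinarith
  · have := (hpos m hm).ne'
    simp only [lenAt]
    field_simp
    ring

end Front

/-! ### The particle system of a front and its first collision -/

theorem freePhase_of_isLeast {S : Finset Particle} {τ : ℝ} (h : IsLeast (collisionTimes S) τ) :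
    freePhase S = Set.Icc 0 τ := by
  ext t
  exact ⟨fun ht => ⟨ht.1, ht.2 τ h.1⟩, fun ht => ⟨ht.1, fun s hs => ht.2.trans (h.2 hs)⟩⟩

theorem next_of_isLeast {S : Finset Particle} {τ : ℝ} (h : IsLeast (collisionTimes S) τ) :
    next S = merge S τ := by
  rw [next, if_pos ⟨τ, h.1⟩, h.csInf_eq]

theorem next_empty : next ∅ = ∅ := by
  have : ¬(collisionTimes ∅).Nonempty := by
    rintro ⟨t, -, p, hp, -⟩
    simp at hp
  rw [next, if_neg this]

theorem mem_merge {S : Finset Particle} {t : ℝ} {q : Particle} :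
    q ∈ merge S t ↔ ∃ x, momentumAt S t x ≠ 0 ∧ q = Particle.ofMomentum x (momentumAt S t x) := by
  classical
  simp only [merge, Finset.mem_image, Finset.mem_filter]
  constructor
  · rintro ⟨x, ⟨-, hx⟩, rfl⟩
    exact ⟨x, hx, rfl⟩
  · rintro ⟨x, hx, rfl⟩
    refine ⟨x, ⟨?_, hx⟩, rfl⟩
    obtain ⟨q, hq, -⟩ := Finset.exists_ne_zero_of_sum_ne_zero hx
    exact ⟨q, (Finset.mem_filter.mp hq).1, (Finset.mem_filter.mp hq).2⟩

theorem ne_zero_of_latticeLength_eq_one {u : ℤ × ℤ} (h : latticeLength u = 1) : u ≠ 0 := by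
  rintro rfl
  simp [latticeLength] at h

namespace Front

variable {ι : Type} (W : Front ι)

/-- The particle of mass one at a vertex. -/
def particle (i : ι) : Particle := ⟨W.vertex i, 1, W.vel i⟩

theorem posAfter_particle (i : ι) (t : ℝ) : (W.particle i).posAfter t = W.point i t := rfl

theorem vertex_injective [Finite ι] : Function.Injective W.vertex := by
  intro i j h
  by_contra hij
  refine W.point_ne (t := 0) (fun i => ?_) hij (by rw [point_zero, point_zero, h])
  rw [lenAt_zero]
  exact W.len_pos i

theorem particle_injective [Finite ι] : Function.Injective W.particle := fun _ _ h =>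
  W.vertex_injective (congrArg Particle.pos h)

/-- At the time `τ` some side collapses for the first time. -/
structure IsCollapse (τ : ℝ) : Prop where
  pos : 0 < τ
  lenAt_nonneg : ∀ i, 0 ≤ W.lenAt i τ
  exists_lenAt_eq_zero : ∃ i, W.lenAt i τ = 0

variable [Fintype ι]

open Classical in
/-- The particles of mass one at all vertices. -/
def particles : Finset Particle := Finset.univ.image W.particle

theorem mem_particles {q : Particle} : q ∈ W.particles ↔ ∃ i, W.particle i = q := by
  simp [particles]

variable {W} in
theorem IsCollapse.isLeast {τ : ℝ} (h : W.IsCollapse τ) :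
    IsLeast (collisionTimes W.particles) τ := by
  constructor
  · obtain ⟨i, hi⟩ := h.exists_lenAt_eq_zero
    refine ⟨h.pos, _, W.mem_particles.mpr ⟨W.succ i, rfl⟩, _, W.mem_particles.mpr ⟨i, rfl⟩,
      W.particle_injective.ne (W.succ_ne i), ?_⟩
    rw [posAfter_particle, posAfter_particle, point_succ, hi]
    simp
  · rintro t ⟨ht, p, hp, q, hq, hpq, e⟩
    obtain ⟨i, rfl⟩ := W.mem_particles.mp hp
    obtain ⟨j, rfl⟩ := W.mem_particles.mp hq
    by_contra! hlt
    exact W.point_ne (W.lenAt_pos_of_lt h.lenAt_nonneg ht.le hlt)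
      (fun hij => hpq (congrArg W.particle hij)) e

open Classical in
theorem momentumAt_eq_sum (t : ℝ) (y : ℝ × ℝ) :
    momentumAt W.particles t y = ∑ i, if W.point i t = y then W.vel i else 0 := by
  rw [momentumAt, Finset.sum_filter, particles,
    Finset.sum_image fun _ _ _ _ h => W.particle_injective h]
  refine Finset.sum_congr rfl fun i _ => ?_
  rw [posAfter_particle]
  simp [Particle.momentum, particle]

/-- The momentum at a point in terms of the sides which start or end there. -/
theorem momentumAt_eq [DecidableEq (ℝ × ℝ)] (t : ℝ) (y : ℝ × ℝ) :
    momentumAt W.particles t y = ∑ i, ((if W.point i t = y then W.dir i else 0) -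
      (if W.point (W.succ i) t = y then W.dir i else 0)) := by
  rw [momentumAt_eq_sum, Finset.sum_sub_distrib,
    ← Equiv.sum_comp W.succ.symm fun i => if W.point (W.succ i) t = y then W.dir i else 0,
    ← Finset.sum_sub_distrib]
  refine Finset.sum_congr rfl fun i _ => ?_
  rw [Equiv.apply_symm_apply]
  split_ifs <;> simp [vel]

theorem momentumAt_vertex (i : ι) : momentumAt W.particles 0 (W.vertex i) = W.vel i := by
  rw [momentumAt_eq_sum, Finset.sum_eq_single i]
  · simp [point_zero]
  · intro j _ hj
    rw [point_zero, if_neg fun h => hj (W.vertex_injective h)]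
  · simp

omit [Fintype ι] in
theorem point_succ_of_lenAt_eq_zero {i : ι} {t : ℝ} (h : W.lenAt i t = 0) :
    W.point (W.succ i) t = W.point i t := by
  rw [point_succ, h]; simp

/-- The sides which collapse are isolated, and each of them is the sum of its neighbours. -/
structure IsSimpleCollapse (τ : ℝ) : Prop extends W.IsCollapse τ where
  turn_eq_one : ∀ i, W.lenAt i τ = 0 → W.turn i = 1
  lenAt_succ_ne_zero : ∀ i, W.lenAt i τ = 0 → W.lenAt (W.succ i) τ ≠ 0

variable {W} {τ : ℝ}

omit [Fintype ι] in
theorem IsCollapse.lenAt_eq_zero (h : W.IsCollapse τ) {i : ι} (hi : ¬0 < W.lenAt i τ) :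
    W.lenAt i τ = 0 :=
  le_antisymm (not_lt.mp hi) (h.lenAt_nonneg i)

end Front

/-! ### Simple collapses: passing to a front with fewer sides -/

namespace Front

variable {ι : Type} {W : Front ι} {τ : ℝ}

namespace IsSimpleCollapse

theorem lenAt_pred_pos (h : W.IsSimpleCollapse τ) {i : ι} (hi : W.lenAt i τ = 0) :
    0 < W.lenAt (W.succ.symm i) τ := by
  by_contra h'
  exact h.lenAt_succ_ne_zero _ (h.lenAt_eq_zero h') (by simpa using hi)

theorem lenAt_succ_pos (h : W.IsSimpleCollapse τ) {i : ι} (hi : W.lenAt i τ = 0) :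
    0 < W.lenAt (W.succ i) τ := by
  by_contra h'
  exact h.lenAt_succ_ne_zero _ hi (h.lenAt_eq_zero h')

open Classical in
/-- The cyclic order of the sides which do not collapse. -/
def succPerm (h : W.IsSimpleCollapse τ) : Equiv.Perm {i // 0 < W.lenAt i τ} where
  toFun i := if hi : 0 < W.lenAt (W.succ i) τ then ⟨W.succ i, hi⟩ else
    ⟨W.succ (W.succ i), h.lenAt_succ_pos (h.lenAt_eq_zero hi)⟩
  invFun i := if hi : 0 < W.lenAt (W.succ.symm i) τ then ⟨W.succ.symm i, hi⟩ else
    ⟨W.succ.symm (W.succ.symm i), h.lenAt_pred_pos (h.lenAt_eq_zero hi)⟩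
  left_inv i := by
    apply Subtype.ext
    by_cases hi : 0 < W.lenAt (W.succ i) τ
    · simp [hi, i.2]
    · simp [hi]
  right_inv i := by
    apply Subtype.ext
    by_cases hi : 0 < W.lenAt (W.succ.symm i) τ
    · simp [hi, i.2]
    · simp [hi]

theorem succPerm_of_pos (h : W.IsSimpleCollapse τ) {i : {i // 0 < W.lenAt i τ}}
    (hi : 0 < W.lenAt (W.succ i) τ) : (h.succPerm i : ι) = W.succ i := by
  simp [succPerm, hi]

theorem succPerm_of_not_pos (h : W.IsSimpleCollapse τ) {i : {i // 0 < W.lenAt i τ}}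
    (hi : ¬0 < W.lenAt (W.succ i) τ) : (h.succPerm i : ι) = W.succ (W.succ i) := by
  simp [succPerm, hi]

theorem point_succPerm (h : W.IsSimpleCollapse τ) (i : {i // 0 < W.lenAt i τ}) :
    W.point (h.succPerm i) τ = W.point (W.succ i) τ := by
  by_cases hi : 0 < W.lenAt (W.succ i) τ
  · rw [h.succPerm_of_pos hi]
  · rw [h.succPerm_of_not_pos hi, point_succ_of_lenAt_eq_zero W (h.lenAt_eq_zero hi)]

theorem dir_pred_add_dir_succ (h : W.IsSimpleCollapse τ) {i : ι} (hi : W.lenAt i τ = 0) :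
    W.dir (W.succ.symm i) + W.dir (W.succ i) = W.dir i := by
  rw [W.dir_pred_add_dir_succ, h.turn_eq_one i hi, one_smul]

/-- The front formed at the time `τ` by the sides which do not collapse. -/
def front (h : W.IsSimpleCollapse τ) : Front {i // 0 < W.lenAt i τ} where
  succ := h.succPerm
  vertex i := W.point i τ
  dir i := W.dir i
  len i := W.lenAt i τ
  len_pos i := i.2
  vertex_succ i := by rw [point_succPerm, point_succ]
  cross_succ i := by
    by_cases hi : 0 < W.lenAt (W.succ i) τ
    · rw [h.succPerm_of_pos hi, W.cross_succ]
    · have := h.turn_eq_one _ (h.lenAt_eq_zero hi)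
      rw [turn, Equiv.symm_apply_apply] at this
      rw [h.succPerm_of_not_pos hi, this]
  fan i j hij hisj := by
    rintro ⟨h1, h2⟩
    have hij' : (i : ι) ≠ j := fun e => hij (Subtype.ext e)
    have hisj' : (i : ι) ≠ h.succPerm j := fun e => hisj (Subtype.ext e)
    by_cases hj : 0 < W.lenAt (W.succ j) τ
    · rw [h.succPerm_of_pos hj] at hisj' h2
      exact W.fan i j hij' hisj' ⟨h1, h2⟩
    · rw [h.succPerm_of_not_pos hj] at hisj' h2
      have hisj2 : (i : ι) ≠ W.succ j := fun e => hj (e ▸ i.2)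
      rcases le_total 0 (cross (W.dir (W.succ j)) (W.dir i)) with h3 | h3
      · exact W.fan i (W.succ j) hisj2 hisj' ⟨h3, h2⟩
      · refine W.fan i j hij' hisj2 ⟨h1, ?_⟩
        rw [cross_anticomm]
        omega

/-- The new front starts at level `τ` of the old one, and the gradients of the surviving sides are
unchanged. -/
theorem dist_front (h : W.IsSimpleCollapse τ) (i : {i // 0 < W.lenAt i τ}) (x : ℝ × ℝ) :
    h.front.dist i x = W.dist i x - τ := by
  rw [W.dist_eq i x (W.point i τ), dist_point_self]
  simp [Front.dist, front]

/-- The gradient of the collapsing side is the sum of its neighbours' gradients, and all three sides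
are at level `τ` at the collapse point. Hence where both neighbours are strictly above `τ`, this
side cannot realise the minimum. -/
theorem dist_of_lenAt_eq_zero (h : W.IsSimpleCollapse τ) {i : ι} (hi : W.lenAt i τ = 0)
    (x : ℝ × ℝ) : W.dist i x = W.dist (W.succ.symm i) x + W.dist (W.succ i) x - τ := by
  have h0 := W.dist_point_self (W.succ i) τ
  rw [point_succ_of_lenAt_eq_zero W hi] at h0
  have h1 := W.det_pred_add_det_succ i (x - W.point i τ)
  rw [h.turn_eq_one i hi] at h1
  rw [W.dist_eq i x (W.point i τ), W.dist_eq (W.succ.symm i) x (W.point i τ),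
    W.dist_eq (W.succ i) x (W.point i τ), dist_pred_point, dist_point_self, h0]
  push_cast at h1
  linarith

variable [Fintype ι]

/-- Momentum is a sum over sides, positive at the start and negative at the end. A collapsed side
starts and ends at one point and cancels; the others have the same ends in both fronts. -/
theorem momentumAt_front (h : W.IsSimpleCollapse τ) (y : ℝ × ℝ) :
    momentumAt W.particles τ y = momentumAt h.front.particles 0 y := by
  classical
  rw [momentumAt_eq, momentumAt_eq]
  symm
  convert Finset.sum_subtype_of_mem (s := Finset.univ.filter fun i => 0 < W.lenAt i τ)
    (p := fun i => 0 < W.lenAt i τ)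
    (fun i => (if W.point i τ = y then W.dir i else 0) -
      (if W.point (W.succ i) τ = y then W.dir i else 0)) (by simp) using 1
  · refine Finset.sum_congr (by ext i; simp [i.2]) fun i _ => ?_
    have h1 : h.front.vertex i = W.point i τ := rfl
    have h2 : h.front.vertex (h.front.succ i) = W.point (W.succ i) τ := h.point_succPerm i
    have h3 : h.front.dir i = W.dir i := rfl
    simp only [point_zero, h1, h2, h3]
  · rw [Finset.sum_filter]
    refine Finset.sum_congr rfl fun i _ => ?_
    split_ifs with h1 h2 h3 h3 <;> try rfl
    all_goals
      rw [point_succ_of_lenAt_eq_zero W (h.lenAt_eq_zero ‹_›)] at *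
      simp_all

/-- The vertices of the new front are distinct, so the momentum at each is a single primitive
velocity and the emitted particle has mass one. -/
theorem merge_eq (h : W.IsSimpleCollapse τ) : merge W.particles τ = h.front.particles := by
  ext q
  rw [mem_merge, mem_particles]
  constructor
  · rintro ⟨y, hy, rfl⟩
    obtain ⟨p, hp, -⟩ := Finset.exists_ne_zero_of_sum_ne_zero (h.momentumAt_front y ▸ hy)
    rw [Finset.mem_filter, mem_particles] at hp
    obtain ⟨⟨i, rfl⟩, hi⟩ := hp
    rw [posAfter_particle, point_zero] at hi
    refine ⟨i, ?_⟩
    rw [← hi, h.momentumAt_front, momentumAt_vertex,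
      ofMomentum_of_latticeLength_eq_one _ (h.front.latticeLength_vel i)]
    rfl
  · rintro ⟨i, rfl⟩
    have e := h.momentumAt_front (h.front.vertex i)
    rw [momentumAt_vertex] at e
    refine ⟨h.front.vertex i, ?_, ?_⟩
    · rw [e]
      exact ne_zero_of_latticeLength_eq_one (h.front.latticeLength_vel i)
    · rw [e, ofMomentum_of_latticeLength_eq_one _ (h.front.latticeLength_vel i)]
      rfl

end IsSimpleCollapse

/-! ### Tracing the points where two sides realise the minimum -/

variable [Fintype ι]

/-- The side `i` realises the minimum of the lattice distances at `x`, and this minimum is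
nonnegative. -/
def Active (W : Front ι) (i : ι) (x : ℝ × ℝ) : Prop :=
  0 ≤ W.dist i x ∧ ∀ l, W.dist i x ≤ W.dist l x

/-- The particle process that starts at the front traces, with the correct masses, the points where
two sides realise the minimum of the lattice distances. -/
structure IsTraced (W : Front ι) : Prop where
  active : ∀ k, ∀ q ∈ next^[k] W.particles, ∀ t ∈ freePhase (next^[k] W.particles),
    ∃ i j, i ≠ j ∧ W.Active i (q.posAfter t) ∧ W.Active j (q.posAfter t)
  exists_eq : ∀ x i j, i ≠ j → W.Active i x → W.Active j x →
    ∃ k, ∃ q ∈ next^[k] W.particles, ∃ t ∈ freePhase (next^[k] W.particles), x = q.posAfter t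
  mass : ∀ k, ∀ q ∈ next^[k] W.particles, ∀ t ∈ interior (freePhase (next^[k] W.particles)),
    ∃ i j, i ≠ j ∧ W.dist i (q.posAfter t) = W.dist j (q.posAfter t) ∧
      0 < W.dist i (q.posAfter t) ∧
      (∀ l, l ≠ i → l ≠ j → W.dist i (q.posAfter t) < W.dist l (q.posAfter t)) ∧
      latticeLength (W.dir i - W.dir j) = q.mass

theorem IsCollapse.active_point (h : W.IsCollapse τ) {t : ℝ} (h0 : 0 ≤ t) (ht : t ≤ τ) (i : ι) :
    W.Active i (W.point i t) ∧ W.Active (W.succ.symm i) (W.point i t) := by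
  refine ⟨⟨?_, fun l => ?_⟩, ?_, fun l => ?_⟩
  · rwa [dist_point_self]
  · rw [dist_point_self]
    exact W.le_dist_point h.lenAt_nonneg h0 ht l i
  · rwa [dist_pred_point]
  · rw [dist_pred_point]
    exact W.le_dist_point h.lenAt_nonneg h0 ht l i

theorem IsCollapse.mass_point (h : W.IsCollapse τ) {t : ℝ} (h0 : 0 < t) (ht : t < τ) (i : ι) :
    ∃ i' j', i' ≠ j' ∧ W.dist i' (W.point i t) = W.dist j' (W.point i t) ∧
      0 < W.dist i' (W.point i t) ∧
      (∀ l, l ≠ i' → l ≠ j' → W.dist i' (W.point i t) < W.dist l (W.point i t)) ∧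
      latticeLength (W.dir i' - W.dir j') = 1 := by
  refine ⟨i, W.succ.symm i, (W.pred_ne i).symm, ?_, ?_, fun l hl hl' => ?_, ?_⟩
  · rw [dist_point_self, dist_pred_point]
  · rwa [dist_point_self]
  · rw [dist_point_self]
    refine W.lt_dist_point (W.lenAt_pos_of_lt h.lenAt_nonneg h0.le ht) hl.symm ?_
    rintro rfl
    simp at hl'
  · exact latticeLength_sub_of_cross_eq_one (W.cross_pred i)

theorem IsCollapse.freePhase_particles (h : W.IsCollapse τ) :
    freePhase W.particles = Set.Icc 0 τ := freePhase_of_isLeast h.isLeast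

theorem IsCollapse.next_particles (h : W.IsCollapse τ) :
    next W.particles = merge W.particles τ := next_of_isLeast h.isLeast

/-- It suffices to consider the points at or above the level of the first collapse, and the process
after it. -/
theorem IsCollapse.isTraced (h : W.IsCollapse τ)
    (active : ∀ k, ∀ q ∈ next^[k] (merge W.particles τ),
      ∀ t ∈ freePhase (next^[k] (merge W.particles τ)),
      ∃ i j, i ≠ j ∧ W.Active i (q.posAfter t) ∧ W.Active j (q.posAfter t))
    (exists_eq : ∀ x i j, i ≠ j → W.Active i x → W.Active j x → τ ≤ W.dist i x →
      (∃ i, x = W.point i τ) ∨ ∃ k, ∃ q ∈ next^[k] (merge W.particles τ),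
      ∃ t ∈ freePhase (next^[k] (merge W.particles τ)), x = q.posAfter t)
    (mass : ∀ k, ∀ q ∈ next^[k] (merge W.particles τ),
      ∀ t ∈ interior (freePhase (next^[k] (merge W.particles τ))),
      ∃ i j, i ≠ j ∧ W.dist i (q.posAfter t) = W.dist j (q.posAfter t) ∧
      0 < W.dist i (q.posAfter t) ∧
      (∀ l, l ≠ i → l ≠ j → W.dist i (q.posAfter t) < W.dist l (q.posAfter t)) ∧
      latticeLength (W.dir i - W.dir j) = q.mass) : W.IsTraced := by
  refine ⟨?_, ?_, ?_⟩
  · intro k q hq t ht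
    cases k with
    | zero =>
      obtain ⟨i, rfl⟩ := W.mem_particles.mp hq
      rw [Function.iterate_zero, id, h.freePhase_particles] at ht
      exact ⟨i, W.succ.symm i, (W.pred_ne i).symm, h.active_point ht.1 ht.2 i⟩
    | succ k =>
      rw [Function.iterate_succ_apply, h.next_particles] at hq ht
      exact active k q hq t ht
  · intro x i j hij hi hj
    have hpt : ∀ t, 0 ≤ t → t ≤ τ → (∃ i, x = W.point i t) → ∃ k, ∃ q ∈ next^[k] W.particles,
        ∃ t ∈ freePhase (next^[k] W.particles), x = q.posAfter t := by
      rintro t h0 ht ⟨i, rfl⟩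
      refine ⟨0, W.particle i, W.mem_particles.mpr ⟨i, rfl⟩, t, ?_, rfl⟩
      rw [Function.iterate_zero, id, h.freePhase_particles]
      exact ⟨h0, ht⟩
    rcases lt_or_ge (W.dist i x) τ with hlt | hge
    · refine hpt _ hi.1 hlt.le ?_
      exact W.exists_eq_point (W.lenAt_pos_of_lt h.lenAt_nonneg hi.1 hlt) hij rfl
        (le_antisymm (hj.2 i) (hi.2 j)) hi.2
    · rcases exists_eq x i j hij hi hj hge with hp | ⟨k, q, hq, t, ht, e⟩
      -- The first phase contains its final time, so collapse points count as traced even if nothing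
      -- is emitted there.
      · exact hpt τ h.pos.le le_rfl hp
      · refine ⟨k + 1, q, ?_, t, ?_, e⟩
        · rwa [Function.iterate_succ_apply, h.next_particles]
        · rwa [Function.iterate_succ_apply, h.next_particles]
  · intro k q hq t ht
    cases k with
    | zero =>
      obtain ⟨i, rfl⟩ := W.mem_particles.mp hq
      rw [Function.iterate_zero, id, h.freePhase_particles, interior_Icc] at ht
      exact h.mass_point ht.1 ht.2 i
    | succ k =>
      rw [Function.iterate_succ_apply, h.next_particles] at hq ht
      exact mass k q hq t ht

theorem IsSimpleCollapse.isTraced (h : W.IsSimpleCollapse τ) (ih : h.front.IsTraced) :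
    W.IsTraced := by
  have hle : ∀ l x c, 0 ≤ c → (∀ i, c ≤ h.front.dist i x) → c + τ ≤ W.dist l x := by
    intro l x c hc hx
    have hpos : ∀ l, 0 < W.lenAt l τ → c + τ ≤ W.dist l x := by
      intro l hl
      have := hx ⟨l, hl⟩
      rw [dist_front] at this
      linarith
    by_cases hl : 0 < W.lenAt l τ
    · exact hpos l hl
    · have hl := h.lenAt_eq_zero hl
      rw [h.dist_of_lenAt_eq_zero hl]
      linarith [hpos _ (h.lenAt_pred_pos hl), hpos _ (h.lenAt_succ_pos hl)]
  have hlt : ∀ l x c, 0 < c → (∀ i, c ≤ h.front.dist i x) → ¬0 < W.lenAt l τ →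
      c + τ < W.dist l x := by
    intro l x c hc hx hl
    have hl := h.lenAt_eq_zero hl
    have h1 := hx ⟨_, h.lenAt_pred_pos hl⟩
    have h2 := hx ⟨_, h.lenAt_succ_pos hl⟩
    rw [dist_front] at h1 h2
    rw [h.dist_of_lenAt_eq_zero hl]
    linarith
  have hact : ∀ i x, h.front.Active i x → W.Active i x := by
    intro i x hi
    have e : W.dist i x = h.front.dist i x + τ := by rw [dist_front]; ring
    refine ⟨?_, fun l => ?_⟩
    · rw [e]; linarith [hi.1, h.pos]
    · rw [e]; exact hle l x _ hi.1 hi.2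
  refine h.toIsCollapse.isTraced ?_ ?_ ?_
  · intro k q hq t ht
    rw [h.merge_eq] at hq ht
    obtain ⟨i, j, hij, hi, hj⟩ := ih.active k q hq t ht
    exact ⟨i, j, fun e => hij (Subtype.ext e), hact i _ hi, hact j _ hj⟩
  · intro x i j hij hi hj hτ
    have hji : W.dist j x = W.dist i x := le_antisymm (hj.2 i) (hi.2 j)
    have hfr : ∀ l, W.dist i x - τ ≤ h.front.dist l x := by
      intro l
      rw [dist_front]
      linarith [hi.2 l]
    -- A collapsed side can realise the minimum only at level exactly `τ`, hence only at the point
    -- to which it has shrunk.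
    have hcol : ∀ l, W.dist l x = W.dist i x → ¬0 < W.lenAt l τ → x = W.point l τ := by
      intro l hl hl0
      have : W.dist i x = τ := by
        by_contra hne
        have hgt : 0 < W.dist i x - τ := by
          rcases hτ.lt_or_eq with h' | h'
          · linarith
          · exact absurd h'.symm hne
        have := hlt l x _ hgt hfr hl0
        linarith
      obtain ⟨a, ha0, ha1, e⟩ := W.exists_eq_point_add (hl.trans this)
        (fun l => this ▸ hi.2 l)
      rw [h.lenAt_eq_zero hl0] at ha1
      rw [e, le_antisymm ha1 ha0]
      simp
    by_cases hi0 : 0 < W.lenAt i τ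
    · by_cases hj0 : 0 < W.lenAt j τ
      · right
        rw [h.merge_eq]
        refine ih.exists_eq x ⟨i, hi0⟩ ⟨j, hj0⟩ (fun e => hij (congrArg Subtype.val e))
          ⟨?_, fun l => ?_⟩ ⟨?_, fun l => ?_⟩
        · rw [dist_front]; linarith
        · rw [dist_front]; exact hfr l
        · rw [dist_front]; simp only [hji]; linarith
        · rw [dist_front]; simp only [hji]; exact hfr l
      · exact Or.inl ⟨j, hcol j hji hj0⟩
    · exact Or.inl ⟨i, hcol i rfl hi0⟩
  · intro k q hq t ht
    rw [h.merge_eq] at hq ht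
    obtain ⟨i, j, hij, he, hpos, hlt', hm⟩ := ih.mass k q hq t ht
    have hall : ∀ l, h.front.dist i (q.posAfter t) ≤ h.front.dist l (q.posAfter t) := by
      intro l
      by_cases hl : l = i
      · rw [hl]
      by_cases hl' : l = j
      · rw [hl', he]
      exact (hlt' l hl hl').le
    refine ⟨i, j, fun e => hij (Subtype.ext e), ?_, ?_, ?_, hm⟩
    · rw [dist_front, dist_front] at he; linarith
    · rw [dist_front] at hpos; linarith [h.pos]
    · intro l hl hl'
      by_cases hl0 : 0 < W.lenAt l τ
      · have := hlt' ⟨l, hl0⟩ (fun e => hl (congrArg Subtype.val e))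
          (fun e => hl' (congrArg Subtype.val e))
        rw [dist_front, dist_front] at this
        simpa using this
      -- Here the positivity of the level in `mass` is used: at level zero of the new front a
      -- collapsed side may tie.
      · have := hlt l _ _ hpos hall hl0
        rw [dist_front] at this
        linarith

end Front

/-! ### Two equal particles meeting head on -/

theorem iterate_next_empty (k : ℕ) : next^[k] ∅ = ∅ := Function.iterate_fixed next_empty k

theorem latticeLength_two_smul (u : ℤ × ℤ) :
    latticeLength ((2 : ℤ) • u) = 2 * latticeLength u := by
  simp [latticeLength, Int.gcd_mul_left]

theorem ofMomentum_two_smul (x : ℝ × ℝ) {u : ℤ × ℤ} (h : latticeLength u = 1) :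
    Particle.ofMomentum x ((2 : ℤ) • u) = ⟨x, 2, u⟩ := by
  rw [Particle.ofMomentum, latticeLength_two_smul, h]
  simp

theorem toPlane_neg (u : ℤ × ℤ) : toPlane (-u) = -toPlane u := by
  simp [toPlane]

theorem toPlane_ne_zero {u : ℤ × ℤ} (h : u ≠ 0) : toPlane u ≠ 0 := by
  intro h'
  apply h
  simp only [toPlane, Prod.mk_eq_zero, Int.cast_eq_zero] at h'
  exact Prod.ext h'.1 h'.2

section HeadOn

variable {A : ℝ × ℝ} {L : ℝ} {u : ℤ × ℤ} {m : ℕ}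

open Classical in
/-- Two particles of mass `m` moving towards each other along a segment. -/
def headOn (A : ℝ × ℝ) (L : ℝ) (u : ℤ × ℤ) (m : ℕ) : Finset Particle :=
  {⟨A, m, u⟩, ⟨A + L • toPlane u, m, -u⟩}

theorem mem_headOn {q : Particle} :
    q ∈ headOn A L u m ↔ q = ⟨A, m, u⟩ ∨ q = ⟨A + L • toPlane u, m, -u⟩ := by
  simp [headOn]

theorem posAfter_headOn_left (t : ℝ) :
    (⟨A, m, u⟩ : Particle).posAfter t = A + t • toPlane u := rfl

theorem posAfter_headOn_right (t : ℝ) :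
    (⟨A + L • toPlane u, m, -u⟩ : Particle).posAfter t = A + (L - t) • toPlane u := by
  simp only [Particle.posAfter, toPlane_neg, smul_neg, sub_eq_add_neg, add_smul, neg_smul,
    add_assoc]

theorem headOn_ne (hL : 0 < L) (hu : u ≠ 0) :
    (⟨A, m, u⟩ : Particle) ≠ ⟨A + L • toPlane u, m, -u⟩ := by
  intro h
  have := congrArg Particle.pos h
  simp [hL.ne', toPlane_ne_zero hu] at this

theorem isLeast_collisionTimes_headOn (hL : 0 < L) (hu : u ≠ 0) :
    IsLeast (collisionTimes (headOn A L u m)) (L / 2) := by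
  constructor
  · refine ⟨by linarith, _, mem_headOn.mpr (Or.inl rfl), _, mem_headOn.mpr (Or.inr rfl),
      headOn_ne hL hu, ?_⟩
    rw [posAfter_headOn_left, posAfter_headOn_right]
    congr 2
    ring
  · have key : ∀ t : ℝ, A + t • toPlane u = A + (L - t) • toPlane u → t = L / 2 := by
      intro t h
      have := smul_left_injective ℝ (toPlane_ne_zero hu) (add_left_cancel h)
      linarith
    rintro t ⟨-, p, hp, q, hq, hpq, e⟩
    rcases mem_headOn.mp hp with rfl | rfl <;> rcases mem_headOn.mp hq with rfl | rfl
    · exact absurd rfl hpq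
    · rw [posAfter_headOn_left, posAfter_headOn_right] at e
      exact (key t e).ge
    · rw [posAfter_headOn_right, posAfter_headOn_left] at e
      exact (key t e.symm).ge
    · exact absurd rfl hpq

theorem next_headOn (hL : 0 < L) (hu : u ≠ 0) : next (headOn A L u m) = ∅ := by
  classical
  rw [next_of_isLeast (isLeast_collisionTimes_headOn hL hu), Finset.eq_empty_iff_forall_notMem]
  intro q hq
  obtain ⟨x, hx, -⟩ := mem_merge.mp hq
  apply hx
  have h : L - L / 2 = L / 2 := by ring
  rw [momentumAt, Finset.sum_filter, headOn, Finset.sum_pair (headOn_ne hL hu),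
    posAfter_headOn_left, posAfter_headOn_right, h]
  split_ifs <;> simp [Particle.momentum]

theorem freePhase_headOn (hL : 0 < L) (hu : u ≠ 0) :
    freePhase (headOn A L u m) = Set.Icc 0 (L / 2) :=
  freePhase_of_isLeast (isLeast_collisionTimes_headOn hL hu)

end HeadOn

/-! ### Final collapses, onto a segment or a point -/

namespace Front

variable {ι : Type} {W : Front ι} {τ : ℝ}

theorem eq_point_of_lenAt_eq_zero {i : ι} (hi : W.lenAt i τ = 0) {x : ℝ × ℝ}
    (hx : W.dist i x = τ) (hl : ∀ l, τ ≤ W.dist l x) : x = W.point i τ := by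
  obtain ⟨a, h0, h1, rfl⟩ := W.exists_eq_point_add hx hl
  rw [hi] at h1
  rw [le_antisymm h1 h0]
  simp

/-- Sides with collinear directions coincide or are opposite. -/
theorem eq_or_dir_eq_neg {i j : ι} (h : cross (W.dir i) (W.dir j) = 0) :
    j = i ∨ W.dir j = -W.dir i := by
  have e := eq_of_cross_eq_one (W.cross_succ i) (W.dir j)
  rw [h, zero_smul, add_zero] at e
  set c := cross (W.dir j) (W.dir (W.succ i))
  have h1 := W.cross_succ j
  rw [e] at h1
  have h2 : c * cross (W.dir i) (W.dir (W.succ j)) = 1 := by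
    rw [← h1]
    simp only [cross, Prod.smul_fst, Prod.smul_snd, smul_eq_mul]
    ring
  rcases Int.isUnit_iff.mp (IsUnit.of_mul_eq_one _ h2) with hc | hc
  · left
    apply W.dir_injective
    rw [e, hc, one_smul]
  · right
    rw [e, hc, neg_smul, one_smul]

/-- Two opposite sides reach each other at the time `τ`. -/
structure IsOpposite (W : Front ι) (τ : ℝ) (i j : ι) : Prop where
  dir_eq : W.dir j = -W.dir i
  dist_add_dist : ∀ x, W.dist i x + W.dist j x = 2 * τ

theorem isOpposite_of_dist_eq {i j : ι} (h : W.dir j = -W.dir i) {x : ℝ × ℝ}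
    (hi : W.dist i x = τ) (hj : W.dist j x = τ) : W.IsOpposite τ i j := by
  refine ⟨h, fun y => ?_⟩
  rw [W.dist_eq i y x, W.dist_eq j y x, hi, hj, h]
  simp only [det, Prod.fst_neg, Prod.snd_neg]
  push_cast
  ring

namespace IsOpposite

variable {e f : ι}

theorem ne (h : W.IsOpposite τ e f) : e ≠ f := by
  rintro rfl
  have h1 := W.cross_succ e
  have h2 := h.dir_eq
  have h3 : W.dir e = 0 := self_eq_neg.mp h2
  rw [h3] at h1
  simp [cross] at h1

/-- Two numbers at least `τ` with sum `2 * τ` both equal `τ`; so what remains of the region lies on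
one line. -/
theorem dist_eq_left (h : W.IsOpposite τ e f) {x : ℝ × ℝ} (hx : ∀ l, τ ≤ W.dist l x) :
    W.dist e x = τ := by
  linarith [h.dist_add_dist x, hx e, hx f]

theorem dist_eq_right (h : W.IsOpposite τ e f) {x : ℝ × ℝ} (hx : ∀ l, τ ≤ W.dist l x) :
    W.dist f x = τ := by
  linarith [h.dist_add_dist x, hx e, hx f]

theorem exists_eq_add (h : W.IsOpposite τ e f) {x : ℝ × ℝ} (hx : ∀ l, τ ≤ W.dist l x) :
    ∃ a, 0 ≤ a ∧ a ≤ W.lenAt e τ ∧ x = W.point e τ + a • toPlane (W.dir e) :=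
  W.exists_eq_point_add (h.dist_eq_left hx) hx

theorem smul_dir_injective {a b : ℝ} (h : W.point e τ + a • toPlane (W.dir e) =
    W.point e τ + b • toPlane (W.dir e)) : a = b := by
  have hne := ne_zero_of_latticeLength_eq_one (latticeLength_of_cross_eq_one (W.cross_succ e))
  exact smul_left_injective ℝ (toPlane_ne_zero hne) (add_left_cancel h)

theorem le_dist_segment [Finite ι] (hc : W.IsCollapse τ) {a : ℝ} (h0 : 0 ≤ a)
    (h1 : a ≤ W.lenAt e τ) (l : ι) : τ ≤ W.dist l (W.point e τ + a • toPlane (W.dir e)) := by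
  have hA := W.le_dist_point hc.lenAt_nonneg hc.pos.le le_rfl l e
  have hB := W.le_dist_point hc.lenAt_nonneg hc.pos.le le_rfl l (W.succ e)
  rw [point_succ, dist_add_smul] at hB
  rw [dist_add_smul]
  rcases le_total (0 : ℝ) (cross (W.dir l) (W.dir e)) with h | h <;> nlinarith

/-- The two opposite sides become the same segment. -/
theorem point_eq [Finite ι] (h : W.IsOpposite τ e f) (hc : W.IsCollapse τ) :
    W.point f τ = W.point (W.succ e) τ ∧ W.point (W.succ f) τ = W.point e τ := by
  have hP : ∀ j l, τ ≤ W.dist l (W.point j τ) := fun j l =>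
    W.le_dist_point hc.lenAt_nonneg hc.pos.le le_rfl l j
  -- Each of the two sides contains the ends of the other. Comparing the four coordinates forces `a
  -- = W.lenAt e τ` and `b = 0`.
  obtain ⟨a, ha0, ha1, ha⟩ := h.exists_eq_add (hP f)
  obtain ⟨b, hb0, hb1, hb⟩ := h.exists_eq_add (hP (W.succ f))
  obtain ⟨a', ha'0, ha'1, ha'⟩ := W.exists_eq_point_add (h.dist_eq_right (hP (W.succ e)))
    (hP (W.succ e))
  obtain ⟨b', hb'0, hb'1, hb'⟩ := W.exists_eq_point_add (h.dist_eq_right (hP e)) (hP e)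
  have e1 := W.point_succ f τ
  rw [h.dir_eq, toPlane_neg, smul_neg] at e1 ha' hb'
  rw [point_succ, ha, add_assoc, ← sub_eq_add_neg, ← sub_smul] at ha'
  rw [ha, add_assoc, ← sub_eq_add_neg, ← sub_smul] at hb'
  rw [hb, ha, add_assoc, ← sub_eq_add_neg, ← sub_smul] at e1
  have h1 := smul_dir_injective ha'
  have h2 : (0 : ℝ) = a - b' := smul_dir_injective (by rw [zero_smul, add_zero]; exact hb')
  have h3 := smul_dir_injective e1
  constructor
  · rw [ha, point_succ, show a = W.lenAt e τ by linarith]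
  · rw [hb, show b = 0 by linarith, zero_smul, add_zero]

theorem eq_or_eq (h : W.IsOpposite τ e f) {l : ι} (hl : cross (W.dir e) (W.dir l) = 0) :
    l = e ∨ l = f := by
  rcases eq_or_dir_eq_neg hl with h1 | h1
  · exact Or.inl h1
  · exact Or.inr (W.dir_injective (h1.trans h.dir_eq.symm))

theorem lt_dist_segment [Finite ι] (h : W.IsOpposite τ e f) (hc : W.IsCollapse τ) {a : ℝ}
    (h0 : 0 < a) (h1 : a < W.lenAt e τ) {l : ι} (he : l ≠ e) (hf : l ≠ f) :
    τ < W.dist l (W.point e τ + a • toPlane (W.dir e)) := by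
  have hA := W.le_dist_point hc.lenAt_nonneg hc.pos.le le_rfl l e
  have hB := W.le_dist_point hc.lenAt_nonneg hc.pos.le le_rfl l (W.succ e)
  rw [point_succ, dist_add_smul] at hB
  rw [dist_add_smul]
  -- An affine function that is at least `τ` at both ends and not constant exceeds `τ` inside; only
  -- `e` and `f` are parallel to the segment.
  have hne : (cross (W.dir l) (W.dir e) : ℝ) ≠ 0 := by
    intro h'
    have h2 : cross (W.dir l) (W.dir e) = 0 := by exact_mod_cast h'
    rw [cross_anticomm, neg_eq_zero] at h2
    rcases h.eq_or_eq h2 with h3 | h3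
    · exact he h3
    · exact hf h3
  rcases hne.lt_or_gt with h2 | h2 <;> nlinarith

variable [Fintype ι]

/-- All vertices lie on the line of `e`, so a side of positive length is parallel to it, hence is
`e` or `f`. These run along the segment in opposite senses, so their contributions at each end
double. -/
theorem momentumAt_eq_smul [DecidableEq (ℝ × ℝ)] (h : W.IsOpposite τ e f) (hc : W.IsCollapse τ)
    (y : ℝ × ℝ) : momentumAt W.particles τ y =
      (if W.point e τ = y then (2 : ℤ) • W.dir e else 0) +
      (if W.point (W.succ e) τ = y then (2 : ℤ) • -W.dir e else 0) := by
  rw [momentumAt_eq, Finset.sum_eq_add e f h.ne, h.dir_eq, (h.point_eq hc).1, (h.point_eq hc).2]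
  · split_ifs <;> ext <;> simp <;> ring
  · intro i _ hi
    by_cases hl : W.lenAt i τ = 0
    · rw [point_succ_of_lenAt_eq_zero W hl, sub_self]
    · exfalso
      have hP : ∀ j l, τ ≤ W.dist l (W.point j τ) := fun j l =>
        W.le_dist_point hc.lenAt_nonneg hc.pos.le le_rfl l j
      have h1 := h.dist_eq_left (hP i)
      have h2 := h.dist_eq_left (hP (W.succ i))
      rw [point_succ, dist_add_smul, h1] at h2
      have h3 : (cross (W.dir e) (W.dir i) : ℝ) = 0 := by
        have : W.lenAt i τ * (cross (W.dir e) (W.dir i) : ℝ) = 0 := by linarith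
        exact (mul_eq_zero.mp this).resolve_left hl
      rcases h.eq_or_eq (by exact_mod_cast h3) with h4 | h4
      · exact hi.1 h4
      · exact hi.2 h4
  · simp
  · simp

theorem merge_eq (h : W.IsOpposite τ e f) (hc : W.IsCollapse τ) (he : 0 < W.lenAt e τ) :
    merge W.particles τ = headOn (W.point e τ) (W.lenAt e τ) (W.dir e) 2 := by
  classical
  have hd := latticeLength_of_cross_eq_one (W.cross_succ e)
  have hd' : latticeLength (-W.dir e) = 1 := by rw [latticeLength_neg, hd]
  have hne : W.point (W.succ e) τ ≠ W.point e τ := by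
    intro e1
    rw [point_succ] at e1
    have := smul_dir_injective (b := 0) (e1.trans (by simp))
    exact he.ne' this
  have hA : momentumAt W.particles τ (W.point e τ) = (2 : ℤ) • W.dir e := by
    rw [h.momentumAt_eq_smul hc, if_pos rfl, if_neg hne, add_zero]
  have hB : momentumAt W.particles τ (W.point (W.succ e) τ) = (2 : ℤ) • -W.dir e := by
    rw [h.momentumAt_eq_smul hc, if_pos rfl, if_neg hne.symm, zero_add]
  ext q
  rw [mem_merge, mem_headOn, ← point_succ]
  constructor
  · rintro ⟨y, hy, rfl⟩
    by_cases h1 : W.point e τ = y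
    · left
      rw [← h1, hA, ofMomentum_two_smul _ hd]
    by_cases h2 : W.point (W.succ e) τ = y
    · right
      rw [← h2, hB, ofMomentum_two_smul _ hd']
    · rw [h.momentumAt_eq_smul hc, if_neg h1, if_neg h2] at hy
      simp at hy
  · rintro (rfl | rfl)
    · refine ⟨W.point e τ, ?_, ?_⟩
      · rw [hA]
        exact smul_ne_zero two_ne_zero (ne_zero_of_latticeLength_eq_one hd)
      · rw [hA, ofMomentum_two_smul _ hd]
    · refine ⟨W.point (W.succ e) τ, ?_, ?_⟩
      · rw [hB]
        exact smul_ne_zero two_ne_zero (ne_zero_of_latticeLength_eq_one hd')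
      · rw [hB, ofMomentum_two_smul _ hd']

theorem isTraced (h : W.IsOpposite τ e f) (hc : W.IsCollapse τ) (he : 0 < W.lenAt e τ) :
    W.IsTraced := by
  have hd := ne_zero_of_latticeLength_eq_one (latticeLength_of_cross_eq_one (W.cross_succ e))
  have hact : ∀ a, 0 ≤ a → a ≤ W.lenAt e τ → ∀ x, x = W.point e τ + a • toPlane (W.dir e) →
      W.dist e x = τ ∧ W.dist f x = τ ∧ ∀ l, τ ≤ W.dist l x := by
    rintro a h0 h1 x rfl
    have := le_dist_segment hc h0 h1
    exact ⟨h.dist_eq_left this, h.dist_eq_right this, this⟩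
  apply hc.isTraced
  · intro k q hq t ht
    rw [h.merge_eq hc he] at hq ht
    cases k with
    | zero =>
      rw [Function.iterate_zero, id] at hq ht
      rw [freePhase_headOn he hd] at ht
      have ⟨a, h0, h1, e1⟩ : ∃ a, 0 ≤ a ∧ a ≤ W.lenAt e τ ∧
          q.posAfter t = W.point e τ + a • toPlane (W.dir e) := by
        rcases mem_headOn.mp hq with rfl | rfl
        · exact ⟨t, ht.1, by linarith [ht.2], posAfter_headOn_left t⟩
        · exact ⟨_, by linarith [ht.2], by linarith [ht.1], posAfter_headOn_right t⟩
      obtain ⟨h2, h3, h4⟩ := hact a h0 h1 _ e1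
      refine ⟨e, f, h.ne, ⟨?_, ?_⟩, ?_, ?_⟩
      · rw [h2]; exact hc.pos.le
      · rwa [h2]
      · rw [h3]; exact hc.pos.le
      · rwa [h3]
    | succ k =>
      rw [Function.iterate_succ_apply, next_headOn he hd, iterate_next_empty] at hq
      simp at hq
  · intro x i j _ hi _ hτ
    right
    rw [h.merge_eq hc he]
    obtain ⟨a, h0, h1, rfl⟩ := h.exists_eq_add fun l => hτ.trans (hi.2 l)
    refine ⟨0, ?_⟩
    rw [Function.iterate_zero, id, freePhase_headOn he hd]
    rcases le_total a (W.lenAt e τ / 2) with ha | ha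
    · exact ⟨_, mem_headOn.mpr (Or.inl rfl), a, ⟨h0, ha⟩, (posAfter_headOn_left a).symm⟩
    · refine ⟨_, mem_headOn.mpr (Or.inr rfl), W.lenAt e τ - a, ⟨by linarith, by linarith⟩, ?_⟩
      rw [posAfter_headOn_right, sub_sub_cancel]
  · intro k q hq t ht
    rw [h.merge_eq hc he] at hq ht
    cases k with
    | zero =>
      rw [Function.iterate_zero, id] at hq ht
      rw [freePhase_headOn he hd, interior_Icc] at ht
      have ⟨a, h0, h1, e1⟩ : ∃ a, 0 < a ∧ a < W.lenAt e τ ∧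
          q.posAfter t = W.point e τ + a • toPlane (W.dir e) := by
        rcases mem_headOn.mp hq with rfl | rfl
        · exact ⟨t, ht.1, by linarith [ht.1, ht.2], posAfter_headOn_left t⟩
        · exact ⟨_, by linarith [ht.1, ht.2], by linarith [ht.1], posAfter_headOn_right t⟩
      obtain ⟨h2, h3, h4⟩ := hact a h0.le h1.le _ e1
      refine ⟨e, f, h.ne, ?_, ?_, fun l hl hl' => ?_, ?_⟩
      · rw [h2, h3]
      · rw [h2]; exact hc.pos
      · rw [h2, e1]
        exact h.lt_dist_segment hc h0 h1 hl hl'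
      · have hm : q.mass = 2 := by rcases mem_headOn.mp hq with rfl | rfl <;> rfl
        rw [hm, h.dir_eq, sub_neg_eq_add, ← two_zsmul, latticeLength_two_smul,
          latticeLength_of_cross_eq_one (W.cross_succ e)]
    | succ k =>
      rw [Function.iterate_succ_apply, next_headOn he hd, iterate_next_empty] at hq
      simp at hq

end IsOpposite

variable [Fintype ι]

/-- The case of a front which shrinks to a point. -/
theorem IsCollapse.isTraced_of_eq (hc : W.IsCollapse τ) {y : ℝ × ℝ}
    (hy : ∀ x, (∀ l, τ ≤ W.dist l x) → x = y) : W.IsTraced := by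
  classical
  have hP : ∀ j, W.point j τ = y := fun j => hy _ fun l =>
    W.le_dist_point hc.lenAt_nonneg hc.pos.le le_rfl l j
  have hm : merge W.particles τ = ∅ := by
    rw [Finset.eq_empty_iff_forall_notMem]
    intro q hq
    obtain ⟨x, hx, -⟩ := mem_merge.mp hq
    apply hx
    rw [momentumAt_eq]
    simp [hP]
  apply hc.isTraced
  · intro k q hq
    rw [hm, iterate_next_empty] at hq
    simp at hq
  · intro x i j _ hi _ hτ
    refine Or.inl ⟨i, ?_⟩
    rw [hP]
    exact hy x fun l => hτ.trans (hi.2 l)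
  · intro k q hq
    rw [hm, iterate_next_empty] at hq
    simp at hq

theorem IsOpposite.isTraced_of_isCollapse {e f : ι} (h : W.IsOpposite τ e f)
    (hc : W.IsCollapse τ) : W.IsTraced := by
  rcases (hc.lenAt_nonneg e).eq_or_lt with he | he
  · exact hc.isTraced_of_eq fun x hx => eq_point_of_lenAt_eq_zero he.symm (h.dist_eq_left hx) hx
  · exact h.isTraced hc he

/-- A collapse which is not simple is the end of the front or leaves a segment. -/
theorem IsCollapse.isTraced_of_not_isSimpleCollapse (hc : W.IsCollapse τ)
    (h : ¬W.IsSimpleCollapse τ) : W.IsTraced := by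
  have hturn : ∀ i, W.lenAt i τ = 0 → W.turn i = 1 ∨ W.IsTraced := by
    intro i hi
    have hlt : W.turn i < 2 := by
      by_contra! h2
      have h2 : (2 : ℝ) ≤ W.turn i := by exact_mod_cast h2
      have h3 := W.len_pos i
      have h4 := hc.pos
      simp only [lenAt] at hi
      nlinarith
    have hs := W.dist_point_self (W.succ i) τ
    rw [point_succ_of_lenAt_eq_zero W hi] at hs
    -- With negative turn, the heights above `τ` of side `i` and its neighbours are nonnegative but
    -- related with the wrong sign, so side `i` stays at level `τ` and only its collapse point is
    -- left. With turn zero the neighbours are opposite.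
    rcases lt_trichotomy (W.turn i) 0 with h0 | h0 | h0
    · right
      refine hc.isTraced_of_eq (y := W.point i τ) fun x hx => ?_
      refine eq_point_of_lenAt_eq_zero hi ?_ hx
      have h1 := W.det_pred_add_det_succ i (x - W.point i τ)
      have h2 := W.dist_eq i x (W.point i τ)
      have h3 := W.dist_eq (W.succ.symm i) x (W.point i τ)
      have h4 := W.dist_eq (W.succ i) x (W.point i τ)
      rw [dist_point_self] at h2
      rw [dist_pred_point] at h3
      rw [hs] at h4
      have h5 : (W.turn i : ℝ) ≤ -1 := by exact_mod_cast Int.le_sub_one_of_lt h0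
      have h6 := hx i
      have h7 := hx (W.succ.symm i)
      have h8 := hx (W.succ i)
      have h9 : 0 ≤ det (W.dir i) (x - W.point i τ) := by linarith
      nlinarith
    · right
      have h1 := W.dir_pred_add_dir_succ i
      rw [h0, zero_smul] at h1
      exact (isOpposite_of_dist_eq (eq_neg_of_add_eq_zero_right h1) (W.dist_pred_point i τ)
        hs).isTraced_of_isCollapse hc
    · left
      omega
  by_contra hT
  have ht : ∀ i, W.lenAt i τ = 0 → W.turn i = 1 := fun i hi => (hturn i hi).resolve_right hT
  refine h ⟨hc, ht, fun i hi hs => hT ?_⟩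
  have h1 := W.dir_pred_add_dir_succ i
  have h2 := W.dir_pred_add_dir_succ (W.succ i)
  rw [ht i hi, one_smul] at h1
  rw [ht _ hs, one_smul, Equiv.symm_apply_apply] at h2
  -- Two adjacent collapsing sides of turn one: adding both neighbour relations makes the outer
  -- neighbours opposite.
  have h3 : W.dir (W.succ (W.succ i)) = -W.dir (W.succ.symm i) := by
    rw [← h1] at h2
    linear_combination h2
  refine (isOpposite_of_dist_eq h3 (W.dist_pred_point i τ) ?_).isTraced_of_isCollapse hc
  have := W.dist_point_self (W.succ (W.succ i)) τ
  rwa [point_succ_of_lenAt_eq_zero W hs, point_succ_of_lenAt_eq_zero W hi] at this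

end Front

/-! ### Induction on the number of sides -/

/-- Every front is traced by its particle process. -/
theorem Front.isTraced {ι : Type} [Fintype ι] [Nonempty ι] (W : Front ι) : W.IsTraced := by
  suffices H : ∀ n : ℕ, ∀ (ι : Type) [Fintype ι] [Nonempty ι] (W : Front ι),
      Fintype.card ι = n → W.IsTraced from H _ ι W rfl
  clear W
  intro n
  induction n using Nat.strong_induction_on with
  | _ n ih =>
    intro ι _ _ W hn
    obtain ⟨τ, h1, h2, h3⟩ := W.exists_collapse
    have hc : W.IsCollapse τ := ⟨h1, h2, h3⟩
    by_cases h : W.IsSimpleCollapse τ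
    · obtain ⟨i, hi⟩ := h3
      have : Nonempty {i // 0 < W.lenAt i τ} := ⟨⟨_, h.lenAt_succ_pos hi⟩⟩
      refine h.isTraced (ih _ ?_ _ h.front rfl)
      rw [← hn]
      exact Fintype.card_subtype_lt (x := i) (by rw [hi]; exact lt_irrefl 0)
    · exact hc.isTraced_of_not_isSimpleCollapse h

/-! ### The region of a front and the corner locus of the minimum -/

/-- Linear functionals of the plane in terms of a lattice basis. -/
theorem map_eq_of_cross_eq_one {u w : ℤ × ℤ} (h : cross u w = 1) (f : ℝ × ℝ →ₗ[ℝ] ℝ)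
    (x : ℝ × ℝ) : f x = det u x * f (toPlane w) - det w x * f (toPlane u) := by
  have h' : (u.1 * w.2 - u.2 * w.1 : ℝ) = 1 := by exact_mod_cast h
  have e : x = det u x • toPlane w - det w x • toPlane u := by
    ext
    · simp only [det, toPlane, Prod.fst_sub, Prod.smul_fst, smul_eq_mul]
      linear_combination (-x.1) * h'
    · simp only [det, toPlane, Prod.snd_sub, Prod.smul_snd, smul_eq_mul]
      linear_combination (-x.2) * h'
  conv_lhs => rw [e]
  simp

/-- The determinant as a continuous linear functional. -/
def detCLM (u : ℤ × ℤ) : ℝ × ℝ →L[ℝ] ℝ :=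
  (u.1 : ℝ) • ContinuousLinearMap.snd ℝ ℝ ℝ - (u.2 : ℝ) • ContinuousLinearMap.fst ℝ ℝ ℝ

theorem detCLM_apply (u : ℤ × ℤ) (x : ℝ × ℝ) : detCLM u x = det u x := by
  simp [detCLM, det]

theorem detCLM_injective : Function.Injective detCLM := by
  intro u w h
  have h1 := congrArg (fun f => f ((1 : ℝ), (0 : ℝ))) h
  have h2 := congrArg (fun f => f ((0 : ℝ), (1 : ℝ))) h
  simp only [detCLM_apply, det] at h1 h2
  ext
  · simpa using h2
  · simpa using h1

namespace Front

variable {ι : Type} (W : Front ι)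

/-- The integral gradient of the lattice distance to a side. -/
theorem dist_eq_affine (i : ι) (x : ℝ × ℝ) : W.dist i x = -det (W.dir i) (W.vertex i) +
    ((-(W.dir i).2 : ℤ) * x.1 + ((W.dir i).1 : ℤ) * x.2) := by
  rw [dist, det_sub]
  simp only [det]
  push_cast
  ring

theorem contDiff_dist (i : ι) : ContDiff ℝ ∞ (W.dist i) := by
  unfold dist det
  fun_prop

theorem continuous_dist (i : ι) : Continuous (W.dist i) := (W.contDiff_dist i).continuous

theorem hasFDerivAt_dist (i : ι) (x : ℝ × ℝ) :
    HasFDerivAt (W.dist i) (detCLM (W.dir i)) x := by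
  have : W.dist i = fun y => detCLM (W.dir i) y - det (W.dir i) (W.vertex i) := by
    funext y
    rw [dist, det_sub, detCLM_apply]
  rw [this]
  exact (detCLM (W.dir i)).hasFDerivAt.sub_const _

theorem dist_vertex_nonneg [Finite ι] (i j : ι) : 0 ≤ W.dist i (W.vertex j) := by
  have := W.le_dist_point_of_pos (t := 0) (fun i => by rw [lenAt_zero]; exact W.len_pos i) i j
  rwa [point_zero] at this

/-- The region bounded by a front. -/
def region : Set (ℝ × ℝ) := {x | ∀ i, 0 ≤ W.dist i x}

theorem convex_region : Convex ℝ W.region := by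
  intro x hx y hy a b ha hb hab i
  have e : W.dist i (a • x + b • y) = a * W.dist i x + b * W.dist i y := by
    simp only [dist, det_sub, det_add, det_smul]
    linear_combination det (W.dir i) (W.vertex i) * hab
  rw [e]
  exact add_nonneg (mul_nonneg ha (hx i)) (mul_nonneg hb (hy i))

theorem region_mem_nhds [Finite ι] {x : ℝ × ℝ} (hx : ∀ i, 0 < W.dist i x) : W.region ∈ 𝓝 x := by
  have : ∀ᶠ y in 𝓝 x, ∀ i, 0 < W.dist i y :=
    Filter.eventually_all.mpr fun i =>
      (W.continuous_dist i).continuousAt.eventually_const_lt (hx i)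
  exact this.mono fun y hy i => (hy i).le

theorem eventually_lt [Finite ι] {i : ι} {s : ι → Prop} {x : ℝ × ℝ}
    (h : ∀ l, s l → W.dist i x < W.dist l x) :
    ∀ᶠ y in 𝓝 x, ∀ l, s l → W.dist i y < W.dist l y :=
  Filter.eventually_all.mpr fun l => Filter.eventually_imp_distrib_left.mpr fun hl =>
    (W.continuous_dist i).continuousAt.eventually_lt (W.continuous_dist l).continuousAt (h l hl)

theorem convexHull_range_vertex [Finite ι] [Nonempty ι] :
    convexHull ℝ (Set.range W.vertex) = W.region := by
  apply Set.Subset.antisymm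
  · refine convexHull_min ?_ W.convex_region
    rintro - ⟨j, rfl⟩ i
    exact W.dist_vertex_nonneg i j
  · intro x hx
    by_contra hnot
    obtain ⟨f, c, hfx, hf⟩ := geometric_hahn_banach_point_closed (convex_convexHull ℝ _)
      ((Set.finite_range W.vertex).isClosed_convexHull ℝ) hnot
    -- At a vertex minimising the separating functional, `f` does not decrease along either adjacent
    -- side. As `x` lies in the cone spanned by these sides, `f x` cannot be smaller than at the
    -- vertex.
    obtain ⟨m, hm⟩ := Finite.exists_min fun j => f (W.vertex j)
    have h1 : f x < f (W.vertex m) := hfx.trans (hf _ (subset_convexHull ℝ _ ⟨m, rfl⟩))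
    have h2 := map_eq_of_cross_eq_one (W.cross_pred m) f.toLinearMap (x - W.vertex m)
    simp only [ContinuousLinearMap.coe_coe, map_sub] at h2
    have hs := hm (W.succ m)
    have hp := hm (W.succ.symm m)
    have e := W.vertex_succ (W.succ.symm m)
    rw [Equiv.apply_symm_apply] at e
    simp only [W.vertex_succ m, map_add, map_smul, smul_eq_mul] at hs
    simp only [e, map_add, map_smul, smul_eq_mul] at hp
    have h3 : 0 ≤ f (toPlane (W.dir m)) := by
      have := W.len_pos m
      by_contra! h
      nlinarith
    have h4 : f (toPlane (W.dir (W.succ.symm m))) ≤ 0 := by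
      have := W.len_pos (W.succ.symm m)
      by_contra! h
      nlinarith
    have h5 : 0 ≤ det (W.dir m) (x - W.vertex m) := hx m
    have h6 : 0 ≤ det (W.dir (W.succ.symm m)) (x - W.vertex m) := by
      have h7 := hx (W.succ.symm m)
      have h8 := W.dist_pred_point m 0
      rw [point_zero] at h8
      rwa [W.dist_eq _ x (W.vertex m), h8, zero_add] at h7
    nlinarith [mul_nonneg h6 h3, mul_nonneg h5 (neg_nonneg.mpr h4)]

variable [Fintype ι] [Nonempty ι]

/-- The minimum of the lattice distances to the sides. -/
def minDist (x : ℝ × ℝ) : ℝ := Finset.univ.inf' Finset.univ_nonempty fun i => W.dist i x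

theorem minDist_le (i : ι) (x : ℝ × ℝ) : W.minDist x ≤ W.dist i x :=
  Finset.inf'_le _ (Finset.mem_univ i)

theorem minDist_eq {i : ι} {x : ℝ × ℝ} (h : ∀ l, W.dist i x ≤ W.dist l x) :
    W.minDist x = W.dist i x :=
  le_antisymm (W.minDist_le i x) (Finset.le_inf' _ _ fun l _ => h l)

theorem contDiffAt_minDist {i : ι} {x : ℝ × ℝ} (h : ∀ l, l ≠ i → W.dist i x < W.dist l x) :
    ContDiffAt ℝ ∞ W.minDist x := by
  refine (W.contDiff_dist i).contDiffAt.congr_of_eventuallyEq ?_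
  filter_upwards [W.eventually_lt h] with y hy
  refine W.minDist_eq fun l => ?_
  by_cases hl : l = i
  · rw [hl]
  · exact (hy l hl).le

theorem fderiv_minDist {i : ι} {x : ℝ × ℝ} (hd : DifferentiableAt ℝ W.minDist x)
    (h : ∀ l, W.dist i x ≤ W.dist l x) : fderiv ℝ W.minDist x = detCLM (W.dir i) := by
  -- The difference is nowhere positive and vanishes at `x`, so its derivative there is zero.
  have hmax : IsLocalMax (fun y => W.minDist y - W.dist i y) x := by
    refine Filter.Eventually.of_forall fun y => ?_
    simp only [W.minDist_eq h, sub_self, sub_nonpos]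
    exact W.minDist_le i y
  have := hmax.hasFDerivAt_eq_zero (hd.hasFDerivAt.sub (W.hasFDerivAt_dist i x))
  exact sub_eq_zero.mp this

/-- The derivative within the region in a direction in which the function is affine. -/
theorem map_eq_of_hasFDerivWithinAt {f : ℝ × ℝ → ℝ} {f' : ℝ × ℝ →L[ℝ] ℝ} {D : Set (ℝ × ℝ)}
    {x w : ℝ × ℝ} {ε c : ℝ} (hε : 0 < ε) (hf : HasFDerivWithinAt f f' D x)
    (hD : ∀ t ∈ Set.Icc 0 ε, x + t • w ∈ D) (hc : ∀ t ∈ Set.Icc 0 ε, f (x + t • w) = t * c) :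
    f' w = c := by
  have h1 : HasDerivWithinAt (fun t : ℝ => x + t • w) w (Set.Icc 0 ε) 0 := by
    simpa using (((hasDerivAt_id (0 : ℝ)).smul_const w).const_add x).hasDerivWithinAt
  have h2 : HasDerivWithinAt (fun t : ℝ => f (x + t • w)) (f' w) (Set.Icc 0 ε) 0 := by
    refine HasFDerivWithinAt.comp_hasDerivWithinAt (t := D) 0 ?_ h1 hD
    simpa using hf
  have h3 : HasDerivWithinAt (fun t : ℝ => f (x + t • w)) c (Set.Icc 0 ε) 0 := by
    have : HasDerivWithinAt (fun t : ℝ => t * c) c (Set.Icc 0 ε) 0 := by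
      simpa using ((hasDerivAt_id (0 : ℝ)).mul_const c).hasDerivWithinAt
    exact this.congr hc (hc 0 ⟨le_rfl, hε.le⟩)
  exact (uniqueDiffOn_Icc hε 0 ⟨le_rfl, hε.le⟩).eq_deriv _ h2 h3

theorem not_hasFDerivWithinAt_vertex (i : ι) (L : ℝ × ℝ →L[ℝ] ℝ) :
    ¬HasFDerivWithinAt W.minDist L W.region (W.vertex i) := by
  intro hL
  have hreg : ∀ j, W.vertex j ∈ W.region := fun j l => W.dist_vertex_nonneg l j
  have hz : ∀ j x, x ∈ W.region → W.dist j x = 0 → W.minDist x = 0 := fun j x hx h => by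
    rw [W.minDist_eq (i := j) fun l => h ▸ hx l, h]
  have hseg : ∀ a b : ℝ × ℝ, a ∈ W.region → b ∈ W.region → ∀ t ∈ Set.Icc (0 : ℝ) 1,
      a + t • (b - a) ∈ W.region := fun a b ha hb t ht =>
    W.convex_region.add_smul_sub_mem ha hb ht
  -- The minimum vanishes along the boundary, so the derivative kills both side directions at the
  -- vertex, hence also the velocity, their difference. But along the velocity the minimum equals
  -- the time (`h3`).
  have key : ∀ j k, W.dist k (W.vertex i) = 0 → W.dist k (W.vertex j) = 0 →
      L (W.vertex j - W.vertex i) = 0 := by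
    intro j k hi hj
    refine map_eq_of_hasFDerivWithinAt one_pos hL (hseg _ _ (hreg i) (hreg j)) fun t ht => ?_
    rw [mul_zero]
    refine hz k _ (hseg _ _ (hreg i) (hreg j) t ht) ?_
    have := W.dist_eq k (W.vertex j) (W.vertex i)
    rw [hi, hj] at this
    rw [dist_add, det_smul, hi]
    linear_combination (-t) * this
  have hp := W.dist_pred_point i 0
  have hp' := W.dist_point_self (W.succ.symm i) 0
  have hs := W.dist_point_succ i 0
  have hs' := W.dist_point_self i 0
  rw [point_zero] at hp hp' hs hs'
  have h1 := key _ _ hs' hs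
  have h2 := key _ _ hp hp'
  have e := W.vertex_succ (W.succ.symm i)
  rw [Equiv.apply_symm_apply] at e
  rw [W.vertex_succ, add_sub_cancel_left, map_smul, smul_eq_mul] at h1
  rw [e, sub_add_cancel_left, map_neg, map_smul, smul_eq_mul, neg_eq_zero] at h2
  have h1 := (mul_eq_zero.mp h1).resolve_left (W.len_pos _).ne'
  have h2 := (mul_eq_zero.mp h2).resolve_left (W.len_pos _).ne'
  obtain ⟨τ, hτ, hl, -⟩ := W.exists_collapse
  have h3 : L (toPlane (W.vel i)) = 1 := by
    refine map_eq_of_hasFDerivWithinAt hτ hL (fun t ht l => ?_) fun t ht => ?_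
    · exact ht.1.trans (W.le_dist_point hl ht.1 ht.2 l i)
    · have h4 := W.dist_point_self i t
      rw [mul_one]
      refine (W.minDist_eq (i := i) fun l => ?_).trans h4
      exact h4.trans_le (W.le_dist_point hl ht.1 ht.2 l i)
  rw [vel, toPlane_sub, map_sub, h1, h2] at h3
  norm_num at h3

/-- The corner locus consists of the points where two sides realise the minimum. -/
theorem mem_cornerLocus_iff {x : ℝ × ℝ} : x ∈ cornerLocus W.region W.minDist ↔
    ∃ i j, i ≠ j ∧ W.Active i x ∧ W.Active j x := by
  constructor
  · rintro ⟨hx, hns⟩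
    obtain ⟨i, hi⟩ := Finite.exists_min fun l => W.dist l x
    by_contra! h
    refine hns (W.contDiffAt_minDist (i := i) fun l hl => ?_).contDiffWithinAt
    refine (hi l).lt_of_ne fun e => ?_
    exact h i l hl.symm ⟨hx i, hi⟩ ⟨hx l, fun m => e ▸ hi m⟩
  · rintro ⟨i, j, hij, hi, hj⟩
    have hx : x ∈ W.region := fun l => hi.1.trans (hi.2 l)
    refine ⟨hx, fun hs => ?_⟩
    have hd := hs.differentiableWithinAt (by simp)
    rcases hi.1.eq_or_lt with h0 | h0
    · obtain ⟨k, rfl⟩ := W.exists_eq_point (t := 0)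
        (fun i => by rw [lenAt_zero]; exact W.len_pos i) hij h0.symm
        (le_antisymm (h0 ▸ hj.2 i) hj.1) hx
      rw [point_zero] at hd
      exact W.not_hasFDerivWithinAt_vertex k _ hd.hasFDerivWithinAt
    · have hd' := hd.differentiableAt (W.region_mem_nhds fun l => h0.trans_le (hi.2 l))
      exact hij (W.dir_injective (detCLM_injective
        ((W.fderiv_minDist hd' hi.2).symm.trans (W.fderiv_minDist hd' hj.2))))

theorem hasEdgeMultiplicity {i j : ι} {x : ℝ × ℝ} (hij : i ≠ j) (h : W.dist i x = W.dist j x)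
    (hlt : ∀ l, l ≠ i → l ≠ j → W.dist i x < W.dist l x) (D : Set (ℝ × ℝ)) :
    HasEdgeMultiplicity D W.minDist x (latticeLength (W.dir i - W.dir j)) := by
  refine ⟨(-(W.dir i).2, (W.dir i).1), (-(W.dir j).2, (W.dir j).1),
    -det (W.dir i) (W.vertex i), -det (W.dir j) (W.vertex j), ?_, ?_, ?_, ?_⟩
  · intro e
    simp only [Prod.mk.injEq, neg_inj] at e
    exact hij (W.dir_injective (Prod.ext e.2 e.1))
  · simpa only [dist_eq_affine] using h
  · have h1 : ∀ᶠ y in 𝓝 x, ∀ l, l ≠ i ∧ l ≠ j → W.dist i y < W.dist l y :=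
      W.eventually_lt fun l hl => hlt l hl.1 hl.2
    refine nhdsWithin_le_nhds ?_
    filter_upwards [h1] with y hy
    have hle : ∀ l, min (W.dist i y) (W.dist j y) ≤ W.dist l y := by
      intro l
      by_cases hli : l = i
      · rw [hli]; exact min_le_left _ _
      by_cases hlj : l = j
      · rw [hlj]; exact min_le_right _ _
      exact (min_le_left _ _).trans (hy l ⟨hli, hlj⟩).le
    rw [← dist_eq_affine, ← dist_eq_affine]
    exact le_antisymm (le_min (W.minDist_le i y) (W.minDist_le j y))
      (Finset.le_inf' _ _ fun l _ => hle l)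
  -- Gradients are directions turned by a right angle, which preserves lattice length.
  · simp only [latticeLength, Prod.mk_sub_mk, Prod.fst_sub, Prod.snd_sub]
    rw [Int.gcd_comm, neg_sub_neg, ← neg_sub (W.dir i).2, Int.gcd_neg]

end Front

/-! ### Delzant polygons as fronts -/

namespace RationalPolygon

variable {n : ℕ} (P : RationalPolygon n)

theorem natCast_ne_zero {n k : ℕ} (h0 : 0 < k) (h : k < n) : (k : ZMod n) ≠ 0 := by
  intro h'
  rw [ZMod.natCast_eq_zero_iff] at h'
  exact absurd (Nat.le_of_dvd h0 h') (not_le.mpr h)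

theorem cross_dir_succ_pos (i : ZMod n) : 0 < cross (P.dir i) (P.dir (i + 1)) := by
  have h1 : (1 : ZMod n) ≠ 0 := by
    simpa using natCast_ne_zero (n := n) (k := 1) one_pos (by linarith [P.three_le])
  have h2 : (1 : ZMod n) + 1 ≠ 0 := by
    have := natCast_ne_zero (n := n) (k := 2) two_pos (by linarith [P.three_le])
    rwa [Nat.cast_two, ← one_add_one_eq_two] at this
  have h := P.convex i (i + 1 + 1) (by rw [add_assoc]; simpa using h2) (by simpa using h1)
  rw [P.vertex_succ, P.vertex_succ, add_assoc, add_sub_cancel_left, det_add, det_smul, det_smul,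
    det_toPlane, det_toPlane, cross_self] at h
  have hl := P.len_pos (i + 1)
  have : (0 : ℝ) < cross (P.dir i) (P.dir (i + 1)) := by
    by_contra! h'
    push_cast at h
    nlinarith
  exact_mod_cast this

theorem isUnit_cross_of_basis (b : Module.Basis (Fin 2) ℤ (ℤ × ℤ)) :
    IsUnit (cross (b 0) (b 1)) := by
  have h1 := b.sum_repr ((1 : ℤ), (0 : ℤ))
  have h2 := b.sum_repr ((0 : ℤ), (1 : ℤ))
  rw [Fin.sum_univ_two] at h1 h2
  set p := b.repr ((1 : ℤ), (0 : ℤ))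
  set q := b.repr ((0 : ℤ), (1 : ℤ))
  have h11 := congrArg Prod.fst h1
  have h12 := congrArg Prod.snd h1
  have h21 := congrArg Prod.fst h2
  have h22 := congrArg Prod.snd h2
  simp only [Prod.fst_add, Prod.snd_add, Prod.smul_fst, Prod.smul_snd, smul_eq_mul]
    at h11 h12 h21 h22
  -- This is the determinant of the inverse matrix, whose entries are the coordinates of the
  -- standard vectors.
  refine IsUnit.of_mul_eq_one (p 0 * q 1 - p 1 * q 0) ?_
  have e : cross (b 0) (b 1) * (p 0 * q 1 - p 1 * q 0) =
      (p 0 * (b 0).1 + p 1 * (b 1).1) * (q 0 * (b 0).2 + q 1 * (b 1).2) -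
      (p 0 * (b 0).2 + p 1 * (b 1).2) * (q 0 * (b 0).1 + q 1 * (b 1).1) := by
    simp only [cross]; ring
  rw [e, h11, h12, h21, h22]
  norm_num

variable {P} in
theorem IsDelzant.cross_eq_one (hP : P.IsDelzant) (i : ZMod n) :
    cross (P.dir i) (P.dir (i + 1)) = 1 := by
  obtain ⟨b, h0, h1⟩ := hP i
  have h := isUnit_cross_of_basis b
  rw [h0, h1] at h
  rcases Int.isUnit_iff.mp h with h | h
  · exact h
  · have := P.cross_dir_succ_pos i
    omega

theorem sideDist_vertex_nonneg (i j : ZMod n) : 0 ≤ P.sideDist i (P.vertex j) := by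
  rw [sideDist]
  by_cases h1 : j = i
  · simp [h1, det]
  by_cases h2 : j = i + 1
  · rw [h2, P.vertex_succ, add_sub_cancel_left, det_smul, det_toPlane, cross_self]
    simp
  exact (P.convex i j h1 h2).le

variable {P} in
/-- The boundary of a Delzant polygon as a front. -/
def IsDelzant.front (hP : P.IsDelzant) : Front (ZMod n) where
  succ := Equiv.addRight 1
  vertex := P.vertex
  dir := P.dir
  len := P.len
  len_pos := P.len_pos
  vertex_succ := P.vertex_succ
  cross_succ := hP.cross_eq_one
  fan i j hij hisj := by
    rintro ⟨h1, h2⟩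
    simp only [Equiv.coe_addRight] at hisj h2
    -- If `dir i` were in the cone of `dir j` and `dir (j + 1)`, the distance of their common vertex
    -- to side `i` would be a nonnegative combination of nonpositive numbers, yet convexity makes it
    -- positive.
    have hc := P.convex i (j + 1) (Ne.symm hisj) fun h => hij (add_right_cancel h).symm
    rw [det_eq_of_cross_eq_one (hP.cross_eq_one j)] at hc
    have h3 := P.sideDist_vertex_nonneg j i
    have h4 := P.sideDist_vertex_nonneg (j + 1) i
    have h5 : P.sideDist j (P.vertex i) = -det (P.dir j) (P.vertex (j + 1) - P.vertex i) := by
      rw [sideDist, P.vertex_succ, det_sub, det_sub, det_add, det_smul, det_toPlane, cross_self]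
      simp
    have h6 : P.sideDist (j + 1) (P.vertex i) =
        -det (P.dir (j + 1)) (P.vertex (j + 1) - P.vertex i) := by
      rw [sideDist, det_sub, det_sub]
      ring
    have h1' : (0 : ℝ) ≤ cross (P.dir j) (P.dir i) := by exact_mod_cast h1
    have h2' : (0 : ℝ) ≤ cross (P.dir i) (P.dir (j + 1)) := by exact_mod_cast h2
    rw [h5] at h3
    rw [h6] at h4
    linarith [mul_nonneg h2' h3, mul_nonneg h1' h4]

theorem particles_front [NeZero n] (hP : P.IsDelzant) : hP.front.particles = P.initial := by
  ext q
  simp only [Front.mem_particles, initial, Finset.mem_image, Finset.mem_univ, true_and]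
  refine exists_congr fun i => ?_
  have : hP.front.particle i = ⟨P.vertex i, 1, P.dir i - P.dir (i - 1)⟩ := by
    simp only [Front.particle, Front.vel, IsDelzant.front, Equiv.addRight_symm,
      Equiv.coe_addRight, sub_eq_add_neg]
  rw [this]

end RationalPolygon

end Caustic

end

/-! ### The main theorem -/

theorem mainTheorem9 {n : ℕ} [NeZero n] (P : Caustic.RationalPolygon n) (hP : P.IsDelzant) :
    P.trace = Caustic.cornerLocus P.carrier P.distFun ∧
    ∀ k, ∀ q ∈ P.system k, ∀ t ∈ interior (Caustic.freePhase (P.system k)),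
      Caustic.HasEdgeMultiplicity P.carrier P.distFun (q.posAfter t) q.mass := by
  have hT := hP.front.isTraced
  have hF : P.distFun = hP.front.minDist := rfl
  have hD : P.carrier = hP.front.region := hP.front.convexHull_range_vertex
  have hS : ∀ k, P.system k = Caustic.next^[k] hP.front.particles := fun k => by
    rw [P.particles_front hP]
    rfl
  constructor
  · ext x
    rw [hF, hD, Caustic.Front.mem_cornerLocus_iff]
    constructor
    · rintro ⟨k, q, hq, t, ht, rfl⟩
      rw [hS] at hq ht
      exact hT.active k q hq t ht
    · rintro ⟨i, j, hij, hi, hj⟩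
      obtain ⟨k, q, hq, t, ht, e⟩ := hT.exists_eq x i j hij hi hj
      rw [← hS] at hq ht
      exact ⟨k, q, hq, t, ht, e⟩
  · intro k q hq t ht
    rw [hS] at hq ht
    obtain ⟨i, j, hij, he, -, hlt, hm⟩ := hT.mass k q hq t ht
    rw [hF, ← hm]
    exact hP.front.hasEdgeMultiplicity hij he hlt _
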